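/- Let $\omega,c\in\mathbb R$ with $c^2<4\omega$, and let $$\phi(x)=\phi_{\omega,c}(x)=\left[\frac{\sqrt{\omega}}{4\omega-c^2}\left\{\cosh\big(\sqrt{4\omega-c^2}\,x\big)-\frac{c}{2\sqrt{\omega}}\right\}\right]^{-1/2},\qquad x\in\mathbb R.$$ For real-valued functions in $H^1(\mathbb R)$ put $$\mathcal L_+\eta_1=-\tfrac12\partial_x^2\eta_1+\tfrac12\big(\omega-\tfrac{c^2}{4}\big)\eta_1+\tfrac34 c\,\phi^2\eta_1-\tfrac{15}{32}\phi^4\eta_1,\qquad \mathcal L_-\eta_2=-\tfrac12\partial_x^2\eta_2+\tfrac12\big(\omega-\tfrac{c^2}{4}\big)\eta_2+\tfrac14 c\,\phi^2\eta_2-\tfrac{3}{32}\phi^4\eta_2 ,$$ where $\partial_x^2$ is taken in the sense of distributions, and let $\langle\cdot,\cdot\rangle$ denote the real $L^2(\mathbb R)$ inner product, extended to the $H^{-1}$-$H^1$ duality pairing; thus $$\langle\mathcal L_+\psi,\psi\rangle=\int_{\mathbb R}\tfrac12|\partial_x\psi|^2+\Big(\tfrac12\big(\omega-\tfrac{c^2}{4}\big)+\tfrac34c\,\phi^2-\tfrac{15}{32}\phi^4\Big)\psi^2\,dx,$$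 and similarly for $\mathcal L_-$. For a complex-valued $\eta\in H^1(\mathbb R)$ put $$\widetilde{\mathcal H}_{\omega,c}(\eta,\eta)=\langle\mathcal L_+\operatorname{Re}\eta,\operatorname{Re}\eta\rangle+\langle\mathcal L_-\operatorname{Im}\eta,\operatorname{Im}\eta\rangle .$$ Then there exist constants $C_1,C_2,C>0$, depending only on $\omega$ and $c$, such that: 1. For every real-valued $\psi\in H^1(\mathbb R)$ with $\langle\psi,\phi\rangle=0$, $$\langle\mathcal L_-\psi,\psi\rangle\ge C_1\|\psi\|_{L^2}^2 .$$ 2. For every real-valued $\psi\in H^1(\mathbb R)$ with $\langle\psi,\phi\rangle=\langle\psi,\phi^3\rangle=\langle\psi,\partial_x\phi\rangle=0$, $$\langle\mathcal L_+\psi,\psi\rangle\ge C_2\|\psi\|_{L^2}^2 .$$ 3. For every complex-valued $\eta\in H^1(\mathbb R)$ with $$\langle\operatorname{Im}\eta,\phi\rangle=0,\quad \langle\operatorname{Re}\eta,\phi\rangle=0,\quad \langle\operatorname{Re}\eta,\partial_x\phi\rangle=0,\quad \tfrac12\langle\operatorname{Re}\eta,\phi^3\rangle+\langle\operatorname{Im}\eta,\partial_x\phi\rangle=0,$$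 $$\widetilde{\mathcal H}_{\omega,c}(\eta,\eta)\ge C\|\eta\|_{H^1}^2 ,\qquad \|\eta\|_{H^1}^2=\|\eta\|_{L^2}^2+\|\partial_x\eta\|_{L^2}^2 .$$ -/

import Mathlib

open MeasureTheory

namespace DNLS

/-- `g` is a weak derivative of `f` on the real line: `∫ ζ' f = - ∫ ζ g` for every real-valued
smooth compactly supported test function `ζ`. -/
def IsWeakDeriv {E : Type*} [NormedAddCommGroup E] [NormedSpace ℝ E] (f g : ℝ → E) : Prop :=
  ∀ ζ : ℝ → ℝ, ContDiff ℝ (⊤ : ℕ∞) ζ → HasCompactSupport ζ →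
    ∫ x, deriv ζ x • f x = - ∫ x, ζ x • g x

/-- The Sobolev space `H¹(ℝ; E)`: an element is a square-integrable function together with a
square-integrable weak derivative (which is determined almost everywhere by the function).
It is used with `E = ℝ` and `E = ℂ`. -/
structure H1 (E : Type*) [NormedAddCommGroup E] [NormedSpace ℝ E] where
  /-- the function -/
  toFun : ℝ → E
  /-- its weak derivative -/
  wderiv : ℝ → E
  memLp_toFun : MemLp toFun 2 volume
  memLp_wderiv : MemLp wderiv 2 volume
  isWeakDeriv : IsWeakDeriv toFun wderiv

/-- The product of a continuous compactly supported function and an `L²` function is integrable. -/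
theorem integrable_smul_of_memLp {E : Type*} [NormedAddCommGroup E] [NormedSpace ℝ E]
    {ζ : ℝ → ℝ} (hζ : Continuous ζ) (hc : HasCompactSupport ζ) {f : ℝ → E}
    (hf : MemLp f 2 volume) : Integrable (fun x => ζ x • f x) volume := by
  have h2 : MemLp ζ 2 volume := hζ.memLp_of_hasCompactSupport hc
  have := hf.smul (p := 2) (q := 2) (r := 1) h2
  exact memLp_one_iff_integrable.1 this

/-- Composition with a continuous real-linear map preserves `H¹`. -/
def H1.map {E F : Type*} [NormedAddCommGroup E] [NormedSpace ℝ E] [CompleteSpace E]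
    [NormedAddCommGroup F] [NormedSpace ℝ F] [CompleteSpace F] (T : E →L[ℝ] F) (η : H1 E) :
    H1 F where
  toFun := fun x => T (η.toFun x)
  wderiv := fun x => T (η.wderiv x)
  memLp_toFun := T.comp_memLp' η.memLp_toFun
  memLp_wderiv := T.comp_memLp' η.memLp_wderiv
  isWeakDeriv := by
    intro ζ hζ hc
    have h1 := integrable_smul_of_memLp (hζ.continuous_deriv (by simp)) hc.deriv η.memLp_toFun
    have h2 := integrable_smul_of_memLp hζ.continuous hc η.memLp_wderiv
    have h := congrArg T (η.isWeakDeriv ζ hζ hc)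
    rw [map_neg, ← T.integral_comp_comm h1, ← T.integral_comp_comm h2] at h
    simpa only [map_smul] using h

/-- The real part of a complex-valued `H¹` function. -/
noncomputable def H1.re (η : H1 ℂ) : H1 ℝ := η.map Complex.reCLM

/-- The imaginary part of a complex-valued `H¹` function. -/
noncomputable def H1.im (η : H1 ℂ) : H1 ℝ := η.map Complex.imCLM

/-- The squared `L²` norm `∫ |f|² dx`. -/
noncomputable def normSqL2 {E : Type*} [NormedAddCommGroup E] (f : ℝ → E) : ℝ :=
  ∫ x, ‖f x‖ ^ 2

/-- The squared `H¹` norm `∫ |η|² dx + ∫ |∂ₓη|² dx`. -/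
noncomputable def normSqH1 {E : Type*} [NormedAddCommGroup E] [NormedSpace ℝ E] (η : H1 E) : ℝ :=
  normSqL2 η.toFun + normSqL2 η.wderiv

/-- The `L²` pairing `∫ f g dx` of real-valued functions. -/
noncomputable def pair (f g : ℝ → ℝ) : ℝ := ∫ x, f x * g x

/-- The solitary-wave profile
`φ_{ω,c}(x) = [ √ω / (4ω - c²) · ( cosh(√(4ω - c²) x) - c / (2√ω) ) ]^{-1/2}`, for `c² < 4ω`. -/
noncomputable def phi (ω c : ℝ) (x : ℝ) : ℝ :=
  (Real.sqrt ω / (4 * ω - c ^ 2) *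
    (Real.cosh (Real.sqrt (4 * ω - c ^ 2) * x) - c / (2 * Real.sqrt ω))) ^ (-(1 / 2) : ℝ)

/-- The zeroth order coefficient of `L₊`. -/
noncomputable def potPlus (ω c : ℝ) (x : ℝ) : ℝ :=
  1 / 2 * (ω - c ^ 2 / 4) + 3 / 4 * c * phi ω c x ^ 2 - 15 / 32 * phi ω c x ^ 4

/-- The zeroth order coefficient of `L₋`. -/
noncomputable def potMinus (ω c : ℝ) (x : ℝ) : ℝ :=
  1 / 2 * (ω - c ^ 2 / 4) + 1 / 4 * c * phi ω c x ^ 2 - 3 / 32 * phi ω c x ^ 4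

/-- The differential operator `f ↦ -½ ∂ₓ²f + V f` on twice differentiable functions. -/
noncomputable def schrodingerOp (V f : ℝ → ℝ) (x : ℝ) : ℝ :=
  -(1 / 2) * deriv (deriv f) x + V x * f x

/-- The form on `H¹(ℝ)` of the operator `-½ ∂ₓ² + V`, that is, the `H⁻¹`-`H¹` duality pairing
`⟨(-½ ∂ₓ² + V) η, ζ⟩`, where `∂ₓ²η` is taken in the sense of distributions. -/
noncomputable def schrodingerForm (V : ℝ → ℝ) (η ζ : H1 ℝ) : ℝ :=
  ∫ x, (1 / 2 * (η.wderiv x * ζ.wderiv x) + V x * η.toFun x * ζ.toFun x)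

/-- On test functions `ζ` the form is the value at `ζ` of the distribution `(-½ ∂ₓ² + V) η`. -/
theorem schrodingerForm_test {V : ℝ → ℝ} (hV : Continuous V) (η ζ : H1 ℝ)
    (hζ : ContDiff ℝ (⊤ : ℕ∞) ζ.toFun) (hc : HasCompactSupport ζ.toFun)
    (hd : ζ.wderiv = deriv ζ.toFun) :
    schrodingerForm V η ζ = ∫ x, η.toFun x * schrodingerOp V ζ.toFun x := by
  have hζ' : ContDiff ℝ (⊤ : ℕ∞) (deriv ζ.toFun) := by
    have := contDiff_infty_iff_deriv.1 hζ
    exact this.2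
  have hw := η.isWeakDeriv _ hζ' hc.deriv
  have i1 := integrable_smul_of_memLp hζ'.continuous hc.deriv η.memLp_wderiv
  have i2 := integrable_smul_of_memLp (hζ'.continuous_deriv (by simp)) hc.deriv.deriv
    η.memLp_toFun
  have i3 := integrable_smul_of_memLp (hV.mul hζ.continuous) (hc.mul_left (f := V))
    η.memLp_toFun
  have e1 : schrodingerForm V η ζ
      = 1 / 2 * (∫ x, deriv ζ.toFun x • η.wderiv x)
        + ∫ x, (V * ζ.toFun) x • η.toFun x := by
    rw [← integral_const_mul, ← integral_add (i1.const_mul _) i3]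
    refine integral_congr_ae (Filter.Eventually.of_forall fun x => ?_)
    simp only [hd, smul_eq_mul, Pi.mul_apply]
    ring
  have e2 : (∫ x, η.toFun x * schrodingerOp V ζ.toFun x)
      = -(1 / 2) * (∫ x, deriv (deriv ζ.toFun) x • η.toFun x)
        + ∫ x, (V * ζ.toFun) x • η.toFun x := by
    rw [← integral_const_mul, ← integral_add (i2.const_mul _) i3]
    refine integral_congr_ae (Filter.Eventually.of_forall fun x => ?_)
    simp only [schrodingerOp, smul_eq_mul, Pi.mul_apply]
    ring
  rw [e1, e2, hw]
  ring

/-- `L₊ f = -½ ∂ₓ²f + ½ (ω - c²/4) f + ¾ c φ² f - (15/32) φ⁴ f`. -/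
noncomputable def Lplus (ω c : ℝ) (f : ℝ → ℝ) : ℝ → ℝ := schrodingerOp (potPlus ω c) f

/-- `L₋ f = -½ ∂ₓ²f + ½ (ω - c²/4) f + ¼ c φ² f - (3/32) φ⁴ f`. -/
noncomputable def Lminus (ω c : ℝ) (f : ℝ → ℝ) : ℝ → ℝ := schrodingerOp (potMinus ω c) f

/-- The duality pairing `⟨L₊ η, ζ⟩` of `L₊ η ∈ H⁻¹(ℝ)` with `ζ ∈ H¹(ℝ)`. -/
noncomputable def LplusPair (ω c : ℝ) (η ζ : H1 ℝ) : ℝ := schrodingerForm (potPlus ω c) η ζ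

/-- The duality pairing `⟨L₋ η, ζ⟩` of `L₋ η ∈ H⁻¹(ℝ)` with `ζ ∈ H¹(ℝ)`. -/
noncomputable def LminusPair (ω c : ℝ) (η ζ : H1 ℝ) : ℝ := schrodingerForm (potMinus ω c) η ζ

theorem phi_base_pos {ω c : ℝ} (h : c ^ 2 < 4 * ω) (x : ℝ) :
    0 < Real.sqrt ω / (4 * ω - c ^ 2) *
      (Real.cosh (Real.sqrt (4 * ω - c ^ 2) * x) - c / (2 * Real.sqrt ω)) := by
  have hω : 0 < ω := by nlinarith [sq_nonneg c]
  have hs : 0 < Real.sqrt ω := Real.sqrt_pos.2 hω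
  have h1 := Real.one_le_cosh (Real.sqrt (4 * ω - c ^ 2) * x)
  have h2 : c / (2 * Real.sqrt ω) < 1 := by
    rw [div_lt_one (by positivity)]
    refine lt_of_pow_lt_pow_left₀ 2 (by positivity) ?_
    rw [mul_pow, Real.sq_sqrt hω.le]
    linarith
  exact mul_pos (div_pos hs (by linarith)) (by linarith)

theorem continuous_phi {ω c : ℝ} (h : c ^ 2 < 4 * ω) : Continuous (phi ω c) := by
  unfold phi
  refine Continuous.rpow_const (by fun_prop) fun x => Or.inl (phi_base_pos h x).ne'

/-- The pairing of `L₊ η` with a test function `ζ` is `∫ η (L₊ ζ) dx`. -/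
theorem LplusPair_test {ω c : ℝ} (h : c ^ 2 < 4 * ω) (η ζ : H1 ℝ)
    (hζ : ContDiff ℝ (⊤ : ℕ∞) ζ.toFun) (hc : HasCompactSupport ζ.toFun)
    (hd : ζ.wderiv = deriv ζ.toFun) :
    LplusPair ω c η ζ = ∫ x, η.toFun x * Lplus ω c ζ.toFun x := by
  have := continuous_phi h
  exact schrodingerForm_test (by unfold potPlus; fun_prop) η ζ hζ hc hd

/-- The pairing of `L₋ η` with a test function `ζ` is `∫ η (L₋ ζ) dx`. -/
theorem LminusPair_test {ω c : ℝ} (h : c ^ 2 < 4 * ω) (η ζ : H1 ℝ)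
    (hζ : ContDiff ℝ (⊤ : ℕ∞) ζ.toFun) (hc : HasCompactSupport ζ.toFun)
    (hd : ζ.wderiv = deriv ζ.toFun) :
    LminusPair ω c η ζ = ∫ x, η.toFun x * Lminus ω c ζ.toFun x := by
  have := continuous_phi h
  exact schrodingerForm_test (by unfold potMinus; fun_prop) η ζ hζ hc hd

/-- The quadratic form `H̃_{ω,c}(η, η) = ⟨L₊ Re η, Re η⟩ + ⟨L₋ Im η, Im η⟩` (the linearized
energy) of a complex-valued `H¹` function. -/
noncomputable def linEnergy (ω c : ℝ) (η : H1 ℂ) : ℝ :=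
  LplusPair ω c η.re η.re + LminusPair ω c η.im η.im

end DNLS

/-!
The statement is proved by explicit computations with the solitary wave, without spectral theory.

In the variable `y = √(4ω - c²) x`, and with `a = c / (2√ω) ∈ (-1, 1)`, the wave is a multiple of
`prof = (cosh y - a)^{-1/2}`, and `L₋`, `L₊` are multiples of `-∂² + pMinus`, `-∂² + pPlus`, which
annihilate `prof` and `prof'` respectively. Elements of `H¹(ℝ)` are replaced by their absolutely
continuous representatives (`H1.exists_isSob`, `IsSob`), for which one can integrate by parts and
evaluate at points.

Positivity comes from Riccati inequalities: if `g' + g² + δ ≤ P`, then `f'² + P f² - δ f²` is at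
least `(g f²)'` (`IsSob.riccati`). Here `g` is a small perturbation of the logarithmic derivative of
the function annihilated by the operator. For `L₋` this gives coercivity on functions vanishing at
the origin. A general `v` is reduced to that case by subtracting a multiple of `prof`, which leaves
the energy unchanged, and does not decrease the norm if `v` is orthogonal to `prof`
(`IsSob.coercive_minus`). Likewise, the energy of `L₊` of a function vanishing at the origin controls
its distance, on each half-line, to the span of `prof'`: subtract the multiple of `prof'` that makes
the function vanish at the inflection point of `prof` too (`IsSob.coercive_plus_of_zero`).

The remaining direction is handled by duality. An explicit `Ψ = (dualRe, dualIm)` is mapped by the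
linearised operator to the combination `(½ prof + σ prof³, prof')` of the constraint vectors, where
`σ = √(1 - a²)`, and the quadratic form at `Ψ` is `-σ < 0` (`integral_dual`). Hence, if `U` satisfies
the constraints, then the form at `U` is the form at `U - α Ψ` plus `σ α²`. As `dualRe 0 ≠ 0`, the
number `α` can be chosen so that the real part of `U - α Ψ` vanishes at the origin, where positivity
is known. The multiples of `prof'` on the two half-lines are controlled by the orthogonality of
`Re U` to `prof` and `prof'` (`exists_norm_le`), which yields coercivity in `L²` (`coercive_L2`) and
then in `H¹` (`coercive_H1`). The estimate for `L₊` alone is the case in which the imaginary part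
vanishes.
-/

/-! ### Absolutely continuous functions on the line -/

namespace DNLS

open Filter Topology Set

/-- `f` is a locally absolutely continuous function with almost everywhere derivative `f'`,
encoded by the fundamental theorem of calculus. -/
structure IsPrim (f f' : ℝ → ℝ) : Prop where
  locInt : LocallyIntegrable f' volume
  integral_eq : ∀ a b, ∫ x in a..b, f' x = f b - f a

/-- `f` is the continuous representative of an element of `H¹(ℝ)`, and `f'` is its weak
derivative. -/
structure IsSob (f f' : ℝ → ℝ) : Prop where
  memLp : MemLp f 2 volume
  memLp' : MemLp f' 2 volume
  integral_eq : ∀ a b, ∫ x in a..b, f' x = f b - f a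

theorem IsSob.isPrim {f f' : ℝ → ℝ} (h : IsSob f f') : IsPrim f f' :=
  ⟨h.memLp'.locallyIntegrable (by norm_num), h.integral_eq⟩

namespace IsPrim

variable {f f' g g' : ℝ → ℝ}

theorem eq_integral (h : IsPrim f f') (c : ℝ) : f = fun x => (∫ t in c..x, f' t) + f c := by
  funext x
  rw [h.integral_eq]
  ring

theorem intervalIntegrable (h : IsPrim f f') (a b : ℝ) : IntervalIntegrable f' volume a b :=
  (h.locInt.integrableOn_isCompact isCompact_uIcc).intervalIntegrable

theorem ac (h : IsPrim f f') (a b : ℝ) : AbsolutelyContinuousOnInterval f a b := by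
  have h1 := (h.intervalIntegrable a b).absolutelyContinuousOnInterval_intervalIntegral
    (c := a) left_mem_uIcc
  have h2 : AbsolutelyContinuousOnInterval (fun _ : ℝ => f a) a b :=
    (contDiff_const (n := 1)).contDiffOn.absolutelyContinuousOnInterval
  have h3 := h1.add h2
  rw [h.eq_integral a]
  exact h3

theorem ae_hasDerivAt (h : IsPrim f f') : ∀ᵐ x, HasDerivAt f (f' x) x := by
  filter_upwards [LocallyIntegrable.ae_hasDerivAt_integral h.locInt] with x hx
  have := (hx 0).add_const (f 0)
  rw [h.eq_integral 0]
  simpa using this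

theorem continuous (h : IsPrim f f') : Continuous f := by
  rw [h.eq_integral 0]
  exact (intervalIntegral.continuous_primitive (fun a b => h.intervalIntegrable a b) 0).add continuous_const

theorem of_ac (hl : LocallyIntegrable f' volume)
    (hd : ∀ᵐ x, HasDerivAt f (f' x) x) (hac : ∀ a b, AbsolutelyContinuousOnInterval f a b) :
    IsPrim f f' := by
  refine ⟨hl, fun a b => ?_⟩
  rw [← (hac a b).integral_deriv_eq_sub]
  refine intervalIntegral.integral_congr_ae ?_
  filter_upwards [hd] with x hx _ using hx.deriv.symm

theorem of_hasDerivAt (hd : ∀ x, HasDerivAt f (f' x) x) (hc : Continuous f') : IsPrim f f' :=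
  ⟨hc.locallyIntegrable, fun a b =>
    intervalIntegral.integral_eq_sub_of_hasDerivAt (fun x _ => hd x) (hc.intervalIntegrable a b)⟩

theorem mul (hf : IsPrim f f') (hg : IsPrim g g') :
    IsPrim (fun x => f x * g x) (fun x => f' x * g x + f x * g' x) := by
  refine of_ac ?_ ?_ fun a b => (hf.ac a b).fun_mul (hg.ac a b)
  · refine LocallyIntegrable.add ?_ ?_
    · exact (locallyIntegrable_iff.2 fun K hK =>
        (hf.locInt.integrableOn_isCompact hK).mul_continuousOn hg.continuous.continuousOn hK)
    · exact (locallyIntegrable_iff.2 fun K hK =>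
        (hg.locInt.integrableOn_isCompact hK).continuousOn_mul hf.continuous.continuousOn hK)
  · filter_upwards [hf.ae_hasDerivAt, hg.ae_hasDerivAt] with x h1 h2 using h1.mul h2

end IsPrim

/-! ### Sobolev functions -/

/-- The product of two square-integrable functions is integrable. -/
theorem integrable_mul_L2 {f g : ℝ → ℝ} (hf : MemLp f 2 volume) (hg : MemLp g 2 volume) :
    Integrable (fun x => f x * g x) volume := hf.integrable_mul hg

theorem integrable_sq_L2 {f : ℝ → ℝ} (hf : MemLp f 2 volume) :
    Integrable (fun x => f x ^ 2) volume :=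
  (memLp_two_iff_integrable_sq hf.1).1 hf

theorem memLp_bdd_mul {f g : ℝ → ℝ} (hf : MemLp f 2 volume) (hg : Continuous g)
    {K : ℝ} (hK : ∀ x, |g x| ≤ K) : MemLp (fun x => g x * f x) 2 volume := by
  refine (hf.const_mul K).mono (hg.aestronglyMeasurable.mul hf.1) (Eventually.of_forall fun x => ?_)
  simp only [norm_mul, Real.norm_eq_abs]
  exact mul_le_mul_of_nonneg_right ((hK x).trans (le_abs_self K)) (abs_nonneg _)

theorem memLp_comp_neg {f : ℝ → ℝ} (hf : MemLp f 2 volume) :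
    MemLp (fun x => f (-x)) 2 volume :=
  hf.comp_measurePreserving (Measure.measurePreserving_neg volume)

namespace IsSob

variable {f f' g g' : ℝ → ℝ}

theorem continuous (h : IsSob f f') : Continuous f := h.isPrim.continuous

theorem integrable_sq (h : IsSob f f') : Integrable (fun x => f x ^ 2) volume :=
  integrable_sq_L2 h.memLp

theorem integrable_sq' (h : IsSob f f') : Integrable (fun x => f' x ^ 2) volume :=
  integrable_sq_L2 h.memLp'

theorem add (hf : IsSob f f') (hg : IsSob g g') :
    IsSob (fun x => f x + g x) (fun x => f' x + g' x) := by
  refine ⟨hf.memLp.add hg.memLp, hf.memLp'.add hg.memLp', fun a b => ?_⟩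
  rw [intervalIntegral.integral_add (hf.isPrim.intervalIntegrable a b)
    (hg.isPrim.intervalIntegrable a b), hf.integral_eq, hg.integral_eq]
  ring

theorem const_mul (c : ℝ) (hf : IsSob f f') :
    IsSob (fun x => c * f x) (fun x => c * f' x) := by
  refine ⟨hf.memLp.const_mul c, hf.memLp'.const_mul c, fun a b => ?_⟩
  rw [intervalIntegral.integral_const_mul, hf.integral_eq]
  ring

theorem sub_const_mul (c : ℝ) (hf : IsSob f f') (hg : IsSob g g') :
    IsSob (fun x => f x - c * g x) (fun x => f' x - c * g' x) := by
  have := hf.add (hg.const_mul (-c))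
  simpa only [neg_mul, ← sub_eq_add_neg] using this

theorem reflect (hf : IsSob f f') : IsSob (fun x => f (-x)) (fun x => -f' (-x)) := by
  refine ⟨memLp_comp_neg hf.memLp, (memLp_comp_neg hf.memLp').neg, fun a b => ?_⟩
  rw [intervalIntegral.integral_neg, intervalIntegral.integral_comp_neg (fun x => f' x),
    hf.integral_eq]
  ring

/-- Functions in `H¹` vanish at `+∞`: the derivative of the product is integrable, so the product
has a limit, which is zero since the product is integrable. -/
theorem tendsto_mul_atTop (hf : IsSob f f') (hg : IsSob g g') :
    Tendsto (fun x => f x * g x) atTop (𝓝 0) := by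
  have hp := hf.isPrim.mul hg.isPrim
  have hi : Integrable (fun x => f' x * g x + f x * g' x) volume :=
    (integrable_mul_L2 hf.memLp' hg.memLp).add (integrable_mul_L2 hf.memLp hg.memLp')
  have h1 := (intervalIntegral_tendsto_integral_Ioi 0 hi.integrableOn tendsto_id).add_const
    (f 0 * g 0)
  have h2 : (fun x => (∫ t in (0 : ℝ)..id x, (f' t * g t + f t * g' t)) + f 0 * g 0)
      = fun x => f x * g x := (hp.eq_integral 0).symm
  rw [h2] at h1
  have h3 : IntegrableAtFilter (fun x => f x * g x) atTop volume :=
    ⟨univ, univ_mem, (integrable_mul_L2 hf.memLp hg.memLp).integrableOn⟩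
  have h4 := h3.eq_zero_of_tendsto (fun s hs => by
    rcases mem_atTop_sets.1 hs with ⟨b, hb⟩
    rw [← top_le_iff, ← Real.volume_Ici (a := b)]
    exact measure_mono hb) h1
  rwa [h4] at h1

/-- Integration by parts on a half-line. -/
theorem integral_Ioi_deriv_mul (hf : IsSob f f') (hg : IsSob g g') (p : ℝ) :
    ∫ x in Ioi p, (f' x * g x + f x * g' x) = -(f p * g p) := by
  have hp := hf.isPrim.mul hg.isPrim
  have hi : Integrable (fun x => f' x * g x + f x * g' x) volume :=
    (integrable_mul_L2 hf.memLp' hg.memLp).add (integrable_mul_L2 hf.memLp hg.memLp')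
  have h1 := intervalIntegral_tendsto_integral_Ioi p hi.integrableOn tendsto_id
  have h2 : (fun x => (∫ t in p..id x, (f' t * g t + f t * g' t)))
      = fun x => f x * g x - f p * g p := by
    funext x
    exact hp.integral_eq p x
  rw [h2] at h1
  have h3 := (tendsto_mul_atTop hf hg).sub_const (f p * g p)
  rw [zero_sub] at h3
  exact tendsto_nhds_unique h1 h3

/-- The square at `t` of a Sobolev function vanishing at the origin is bounded by `t` times the
integral of the squared derivative over `[0, t]`. -/
theorem sq_le_mul_integral (hf : IsSob f f') {t : ℝ} (ht : 0 ≤ t) (h0 : f 0 = 0) :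
    f t ^ 2 ≤ t * ∫ x in (0 : ℝ)..t, f' x ^ 2 := by
  have hI : ∀ c : ℝ, 0 ≤ t * c ^ 2 - 2 * c * f t + ∫ x in (0 : ℝ)..t, f' x ^ 2 := by
    intro c
    have h1 : 0 ≤ ∫ x in (0 : ℝ)..t, (f' x - c) ^ 2 :=
      intervalIntegral.integral_nonneg ht fun x _ => sq_nonneg _
    have i1 : IntervalIntegrable (fun x => f' x ^ 2) volume 0 t :=
      hf.integrable_sq'.intervalIntegrable
    have i2 : IntervalIntegrable (fun x => 2 * c * f' x) volume 0 t :=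
      (hf.isPrim.intervalIntegrable 0 t).const_mul _
    have h2 : ∫ x in (0 : ℝ)..t, (f' x - c) ^ 2
        = ∫ x in (0 : ℝ)..t, ((f' x ^ 2 - 2 * c * f' x) + c ^ 2) := by
      congr 1; funext x; ring
    rw [h2, intervalIntegral.integral_add (i1.sub i2) (by simp),
      intervalIntegral.integral_sub i1 i2, intervalIntegral.integral_const_mul,
      hf.integral_eq, h0] at h1
    simp only [intervalIntegral.integral_const, smul_eq_mul, sub_zero] at h1
    linarith
  rcases ht.eq_or_lt with rfl | hpos
  · simp [h0]
  have h := hI (f t / t)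
  have e : t * (f t / t) ^ 2 - 2 * (f t / t) * f t = -(f t ^ 2 / t) := by
    field_simp
    ring
  rw [e] at h
  have h3 : f t ^ 2 / t ≤ ∫ x in (0 : ℝ)..t, f' x ^ 2 := by linarith
  rw [div_le_iff₀ hpos] at h3
  linarith

end IsSob

/-- `g` is a continuously differentiable function, bounded together with its derivative `g'`. -/
structure IsBddC1 (g g' : ℝ → ℝ) : Prop where
  hasDerivAt : ∀ x, HasDerivAt g (g' x) x
  continuous' : Continuous g'
  bdd : ∃ K, ∀ x, |g x| ≤ K
  bdd' : ∃ K, ∀ x, |g' x| ≤ K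

theorem bdd_mul {f g : ℝ → ℝ} (hf : ∃ K, ∀ x, |f x| ≤ K) (hg : ∃ K, ∀ x, |g x| ≤ K) :
    ∃ K, ∀ x, |f x * g x| ≤ K := by
  obtain ⟨K, hK⟩ := hf
  obtain ⟨L, hL⟩ := hg
  refine ⟨K * L, fun x => ?_⟩
  rw [abs_mul]
  exact mul_le_mul (hK x) (hL x) (abs_nonneg _) ((abs_nonneg _).trans (hK x))

theorem bdd_add {f g : ℝ → ℝ} (hf : ∃ K, ∀ x, |f x| ≤ K) (hg : ∃ K, ∀ x, |g x| ≤ K) :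
    ∃ K, ∀ x, |f x + g x| ≤ K := by
  obtain ⟨K, hK⟩ := hf
  obtain ⟨L, hL⟩ := hg
  exact ⟨K + L, fun x => (abs_add_le _ _).trans (add_le_add (hK x) (hL x))⟩

namespace IsBddC1

variable {f f' g g' : ℝ → ℝ}

theorem continuous (hg : IsBddC1 g g') : Continuous g :=
  continuous_iff_continuousAt.2 fun x => (hg.hasDerivAt x).continuousAt

theorem mul (hf : IsBddC1 f f') (hg : IsBddC1 g g') :
    IsBddC1 (fun x => f x * g x) (fun x => f' x * g x + f x * g' x) :=
  ⟨fun x => (hf.hasDerivAt x).mul (hg.hasDerivAt x),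
    (hf.continuous'.mul hg.continuous).add (hf.continuous.mul hg.continuous'),
    bdd_mul hf.bdd hg.bdd, bdd_add (bdd_mul hf.bdd' hg.bdd) (bdd_mul hf.bdd hg.bdd')⟩

theorem add (hf : IsBddC1 f f') (hg : IsBddC1 g g') :
    IsBddC1 (fun x => f x + g x) (fun x => f' x + g' x) :=
  ⟨fun x => (hf.hasDerivAt x).add (hg.hasDerivAt x), hf.continuous'.add hg.continuous',
    bdd_add hf.bdd hg.bdd, bdd_add hf.bdd' hg.bdd'⟩

theorem const (c : ℝ) : IsBddC1 (fun _ => c) (fun _ => 0) :=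
  ⟨fun x => hasDerivAt_const x c, continuous_const, ⟨|c|, fun _ => le_rfl⟩, ⟨0, by simp⟩⟩

theorem const_mul (c : ℝ) (hf : IsBddC1 f f') :
    IsBddC1 (fun x => c * f x) (fun x => c * f' x) := by
  simpa using (const c).mul hf

end IsBddC1

/-- `H¹(ℝ)` is stable under multiplication by bounded `C¹` functions with bounded derivative. -/
theorem IsSob.bddC1_mul {f f' g g' : ℝ → ℝ} (hg : IsBddC1 g g') (hf : IsSob f f') :
    IsSob (fun x => g x * f x) (fun x => g' x * f x + g x * f' x) := by
  obtain ⟨K, hK⟩ := hg.bdd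
  obtain ⟨K', hK'⟩ := hg.bdd'
  exact ⟨memLp_bdd_mul hf.memLp hg.continuous hK,
    (memLp_bdd_mul hf.memLp hg.continuous' hK').add (memLp_bdd_mul hf.memLp' hg.continuous hK),
    ((IsPrim.of_hasDerivAt hg.hasDerivAt hg.continuous').mul hf.isPrim).integral_eq⟩

theorem integral_eq_Ioi_add_Ioi_neg {f : ℝ → ℝ} (hf : Integrable f volume) :
    ∫ x, f x = (∫ x in Ioi (0 : ℝ), f x) + ∫ x in Ioi (0 : ℝ), f (-x) := by
  rw [integral_comp_neg_Ioi, neg_zero, add_comm,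
    intervalIntegral.integral_Iic_add_Ioi hf.integrableOn hf.integrableOn]

theorem integral_eq_zero_of_odd {f : ℝ → ℝ} (h : ∀ x, f (-x) = -f x) : ∫ x, f x = 0 := by
  have h1 := integral_neg_eq_self f volume
  simp only [h, MeasureTheory.integral_neg] at h1
  linarith

/-- Integration by parts on the line. -/
theorem IsSob.integral_deriv_mul {f f' g g' : ℝ → ℝ} (hf : IsSob f f') (hg : IsSob g g') :
    ∫ x, (f' x * g x + f x * g' x) = 0 := by
  have hi : Integrable (fun x => f' x * g x + f x * g' x) volume :=
    (integrable_mul_L2 hf.memLp' hg.memLp).add (integrable_mul_L2 hf.memLp hg.memLp')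
  rw [integral_eq_Ioi_add_Ioi_neg hi, hf.integral_Ioi_deriv_mul hg]
  have h := hf.reflect.integral_Ioi_deriv_mul hg.reflect 0
  rw [← neg_inj, ← MeasureTheory.integral_neg] at h
  have e : ∫ x in Ioi (0 : ℝ), (f' (-x) * g (-x) + f (-x) * g' (-x))
      = ∫ x in Ioi (0 : ℝ), -(-f' (-x) * g (-x) + f (-x) * -g' (-x)) := by
    congr 1; funext x; ring
  rw [e, h]
  simp

theorem cauchy_schwarz {μ : Measure ℝ} {f g : ℝ → ℝ} (hf : MemLp f 2 μ) (hg : MemLp g 2 μ) :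
    (∫ x, f x * g x ∂μ) ^ 2 ≤ (∫ x, f x ^ 2 ∂μ) * ∫ x, g x ^ 2 ∂μ := by
  have i1 : Integrable (fun x => f x ^ 2) μ := (memLp_two_iff_integrable_sq hf.1).1 hf
  have i2 : Integrable (fun x => g x ^ 2) μ := (memLp_two_iff_integrable_sq hg.1).1 hg
  have i3 : Integrable (fun x => f x * g x) μ := hf.integrable_mul hg
  have hq : ∀ t : ℝ, 0 ≤ (∫ x, g x ^ 2 ∂μ) * (t * t) + (2 * ∫ x, f x * g x ∂μ) * t
      + ∫ x, f x ^ 2 ∂μ := by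
    intro t
    have h1 : 0 ≤ ∫ x, (t * g x + f x) ^ 2 ∂μ := integral_nonneg fun x => sq_nonneg _
    have h2 : ∫ x, (t * g x + f x) ^ 2 ∂μ = t * t * (∫ x, g x ^ 2 ∂μ)
        + 2 * t * (∫ x, f x * g x ∂μ) + ∫ x, f x ^ 2 ∂μ := by
      have i4 : Integrable (fun x => t * t * g x ^ 2 + 2 * t * (f x * g x)) μ :=
        (i2.const_mul _).add (i3.const_mul _)
      rw [← integral_const_mul, ← integral_const_mul,
        ← integral_add (i2.const_mul _) (i3.const_mul _), ← integral_add i4 i1]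
      congr 1; funext x; ring
    linarith
  have h := discrim_le_zero hq
  rw [discrim] at h
  linarith

/-! ### Weakly differentiable functions have continuous representatives -/

/-- The du Bois-Reymond lemma: the weak derivative of `h` vanishes only if `h` is constant. -/
theorem ae_const_of_integral_deriv_mul_eq_zero {h : ℝ → ℝ} (hl : LocallyIntegrable h volume)
    (h0 : ∀ ζ : ℝ → ℝ, ContDiff ℝ (⊤ : ℕ∞) ζ → HasCompactSupport ζ → ∫ x, deriv ζ x * h x = 0) :
    ∃ c, ∀ᵐ x, h x = c := by
  obtain ⟨b⟩ : Nonempty (ContDiffBump (0 : ℝ)) := inferInstance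
  set ρ : ℝ → ℝ := b.normed volume with hρ
  have ρs : ContDiff ℝ (⊤ : ℕ∞) ρ := b.contDiff_normed
  have ρc : HasCompactSupport ρ := b.hasCompactSupport_normed
  have ρ1 : ∫ x, ρ x = 1 := b.integral_normed
  have int : ∀ ζ : ℝ → ℝ, Continuous ζ → HasCompactSupport ζ →
      Integrable (fun x => ζ x * h x) volume := fun ζ h1 h2 =>
    hl.integrable_smul_left_of_hasCompactSupport h1 h2
  refine ⟨∫ x, ρ x * h x, ?_⟩
  refine ae_eq_of_integral_contDiff_smul_eq hl (locallyIntegrable_const _) fun ζ ζs ζc => ?_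
  simp only [smul_eq_mul]
  set m := ∫ x, ζ x with hm
  -- `ζ - m ρ` has mean zero, so its primitive is again a test function.
  set χ : ℝ → ℝ := fun x => ζ x - m * ρ x with hχ
  have χs : ContDiff ℝ (⊤ : ℕ∞) χ := ζs.sub (contDiff_const.mul ρs)
  have χc : HasCompactSupport χ := ζc.sub (ρc.mul_left (f := fun _ => m))
  have χi : Integrable χ volume := χs.continuous.integrable_of_hasCompactSupport χc
  have χ0 : ∫ x, χ x = 0 := by
    rw [hχ, integral_sub (ζs.continuous.integrable_of_hasCompactSupport ζc)
      ((ρs.continuous.integrable_of_hasCompactSupport ρc).const_mul _), integral_const_mul, ρ1,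
      ← hm]
    ring
  set θ : ℝ → ℝ := fun x => ∫ t in Iic x, χ t with hθ
  have θd : ∀ x, HasDerivAt θ (χ x) x := by
    intro x
    have e : θ = fun y => (∫ t in Iic 0, χ t) + ∫ t in (0 : ℝ)..y, χ t := by
      funext y
      rw [← intervalIntegral.integral_Iic_sub_Iic χi.integrableOn χi.integrableOn]
      simp [hθ]
    rw [e]
    exact (intervalIntegral.integral_hasDerivAt_right (χs.continuous.intervalIntegrable _ _)
      (χs.continuous.stronglyMeasurableAtFilter _ _) χs.continuous.continuousAt).const_add _
  have θ' : deriv θ = χ := funext fun x => (θd x).deriv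
  have θs : ContDiff ℝ (⊤ : ℕ∞) θ := by
    rw [contDiff_infty_iff_deriv, θ']
    exact ⟨fun x => (θd x).differentiableAt, χs⟩
  have θc : HasCompactSupport θ := by
    obtain ⟨r, hr⟩ := χc.isCompact.isBounded.subset_closedBall 0
    refine HasCompactSupport.intro (isCompact_closedBall (0 : ℝ) r) fun x hx => ?_
    have hz : ∀ t, t ∉ Metric.closedBall (0 : ℝ) r → χ t = 0 := fun t ht =>
      image_eq_zero_of_notMem_tsupport fun h => ht (hr h)
    simp only [Metric.mem_closedBall, dist_zero_right, Real.norm_eq_abs, not_le] at hx hz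
    rcases lt_abs.1 hx with h1 | h1
    · have : ∫ t in Iic x, χ t = ∫ t, χ t := by
        refine setIntegral_eq_integral_of_forall_compl_eq_zero fun t ht => hz t ?_
        simp only [mem_Iic, not_le] at ht
        exact lt_of_lt_of_le (h1.trans ht) (le_abs_self t)
      rw [hθ]
      simp only [this, χ0]
    · refine setIntegral_eq_zero_of_forall_eq_zero fun t ht => hz t ?_
      simp only [mem_Iic] at ht
      exact lt_of_lt_of_le (by linarith) (neg_le_abs t)
  have h1 := h0 θ θs θc
  rw [θ'] at h1
  have h2 : ∫ x, χ x * h x = ∫ x, (ζ x * h x - m * (ρ x * h x)) := by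
    congr 1; funext x; rw [hχ]; ring
  rw [h2, integral_sub (int ζ ζs.continuous ζc) ((int ρ ρs.continuous ρc).const_mul _),
    integral_const_mul] at h1
  rw [integral_mul_const]
  linarith

/-- Every element of `H¹(ℝ)` has a continuous representative. -/
theorem H1.exists_isSob (η : H1 ℝ) : ∃ f, f =ᵐ[volume] η.toFun ∧ IsSob f η.wderiv := by
  have hl : LocallyIntegrable η.wderiv volume := η.memLp_wderiv.locallyIntegrable (by norm_num)
  set F : ℝ → ℝ := fun x => ∫ t in (0 : ℝ)..x, η.wderiv t with hF
  have hint : ∀ a b, IntervalIntegrable η.wderiv volume a b := fun a b =>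
    (hl.integrableOn_isCompact isCompact_uIcc).intervalIntegrable
  have hFp : IsPrim F η.wderiv := ⟨hl, fun a b =>
    (intervalIntegral.integral_interval_sub_left (hint 0 b) (hint 0 a)).symm⟩
  have hle : LocallyIntegrable η.toFun volume := η.memLp_toFun.locallyIntegrable (by norm_num)
  obtain ⟨c, hc⟩ := ae_const_of_integral_deriv_mul_eq_zero
    (h := fun x => η.toFun x - F x) (hle.sub hFp.continuous.locallyIntegrable) (by
      intro ζ ζs ζc
      have w := η.isWeakDeriv ζ ζs ζc
      simp only [smul_eq_mul] at w
      have ζ'c : Continuous (deriv ζ) := ζs.continuous_deriv (by simp)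
      have ζd : ∀ x, HasDerivAt ζ (deriv ζ x) x := fun x =>
        (ζs.differentiable (by simp) x).hasDerivAt
      have i1 : Integrable (fun x => deriv ζ x * η.toFun x) volume :=
        hle.integrable_smul_left_of_hasCompactSupport ζ'c ζc.deriv
      have i2 : Integrable (fun x => deriv ζ x * F x) volume :=
        hFp.continuous.locallyIntegrable.integrable_smul_left_of_hasCompactSupport ζ'c ζc.deriv
      have i3 : Integrable (fun x => ζ x * η.wderiv x) volume :=
        hl.integrable_smul_left_of_hasCompactSupport ζs.continuous ζc
      have hp := (IsPrim.of_hasDerivAt ζd ζ'c).mul hFp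
      obtain ⟨r, hr⟩ := ζc.isCompact.isBounded.subset_closedBall 0
      have hz : ∀ t, r < |t| → ζ t = 0 := fun t ht =>
        image_eq_zero_of_notMem_tsupport fun h => by
          have := hr h
          simp only [Metric.mem_closedBall, dist_zero_right, Real.norm_eq_abs] at this
          linarith
      have h1 := intervalIntegral_tendsto_integral (i2.add i3) tendsto_neg_atTop_atBot tendsto_id
      have h2 : Tendsto (fun R : ℝ => ∫ x in (-R)..(id R), (deriv ζ x * F x + ζ x * η.wderiv x))
          atTop (𝓝 0) := by
        refine tendsto_const_nhds.congr' ?_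
        filter_upwards [eventually_gt_atTop (max r 0)] with R hR
        have hr1 : r < |R| := lt_of_lt_of_le ((le_max_left _ _).trans_lt hR) (le_abs_self R)
        rw [hp.integral_eq, id, hz R hr1, hz (-R) (by rwa [abs_neg])]
        ring
      have h3 := tendsto_nhds_unique h1 h2
      simp only [Pi.add_apply] at h3
      rw [integral_add i2 i3] at h3
      have e : ∫ x, deriv ζ x * (η.toFun x - F x)
          = ∫ x, (deriv ζ x * η.toFun x - deriv ζ x * F x) := by
        congr 1; funext x; ring
      rw [e, integral_sub i1 i2, w]
      linarith)
  have hae : (fun x => F x + c) =ᵐ[volume] η.toFun := by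
    filter_upwards [hc] with x hx
    linarith
  refine ⟨fun x => F x + c, hae, η.memLp_toFun.ae_eq hae.symm, η.memLp_wderiv, fun a b => ?_⟩
  rw [hFp.integral_eq]
  ring

end DNLS

/-! ### Riccati inequalities -/

namespace DNLS

open Filter Topology Set

/-- If `g` is a supersolution of the Riccati equation `g' + g² = P - δ` on `[p, b]`, then the energy
with potential `P - δ` is bounded below by boundary terms, since
`f'² + (g' + g²) f² ≥ 2 g f f' + g' f² = (g f²)'`. -/
theorem IsSob.riccati {f f' g g' P : ℝ → ℝ} {p b δ : ℝ} (hf : IsSob f f') (hpb : p ≤ b)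
    (hP : Continuous P) (hg : ContDiffOn ℝ 1 g (Icc p b))
    (hg' : ∀ x ∈ Ioo p b, HasDerivAt g (g' x) x)
    (hR : ∀ x ∈ Ioo p b, g' x + g x ^ 2 + δ ≤ P x) :
    g b * f b ^ 2 - g p * f p ^ 2
      ≤ ∫ x in p..b, (f' x ^ 2 + P x * f x ^ 2 - δ * f x ^ 2) := by
  have hac := (hf.isPrim.ac p b).mul (hf.isPrim.ac p b)
  have hgac : AbsolutelyContinuousOnInterval g p b := by
    refine ContDiffOn.absolutelyContinuousOnInterval ?_
    rwa [uIcc_of_le hpb]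
  have hprod := hgac.mul hac
  have h1 := hprod.integral_deriv_eq_sub
  have h2 : g b * f b ^ 2 - g p * f p ^ 2 = ∫ x in p..b, deriv (g * (f * f)) x := by
    rw [h1]
    simp only [Pi.mul_apply]
    ring
  rw [h2]
  have i1 : IntervalIntegrable (fun x => f' x ^ 2) volume p b := hf.integrable_sq'.intervalIntegrable
  have i2 : IntervalIntegrable (fun x => P x * f x ^ 2) volume p b :=
    (hP.mul (hf.continuous.pow 2)).intervalIntegrable _ _
  have i3 : IntervalIntegrable (fun x => δ * f x ^ 2) volume p b :=
    (continuous_const.mul (hf.continuous.pow 2)).intervalIntegrable _ _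
  refine intervalIntegral.integral_mono_ae_restrict hpb hprod.intervalIntegrable_deriv
    ((i1.add i2).sub i3) ?_
  rw [EventuallyLE, ae_restrict_iff' measurableSet_Icc]
  have hne : ∀ᵐ x : ℝ, x ≠ p ∧ x ≠ b := by
    have hp : ∀ᵐ x : ℝ, x ≠ p := by simp [ae_iff]
    have hb : ∀ᵐ x : ℝ, x ≠ b := by simp [ae_iff]
    exact hp.and hb
  filter_upwards [hf.isPrim.ae_hasDerivAt, hne] with x hx hn hxI
  have hxo : x ∈ Ioo p b := ⟨lt_of_le_of_ne hxI.1 hn.1.symm, lt_of_le_of_ne hxI.2 hn.2⟩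
  rw [((hg' x hxo).mul (hx.mul hx)).deriv]
  have h3 := hR x hxo
  simp only [Pi.mul_apply]
  nlinarith [sq_nonneg (f' x - g x * f x), mul_nonneg (sub_nonneg.2 h3) (sq_nonneg (f x))]

/-- Integrability of the energy density. -/
theorem IsSob.integrable_energy {f f' P : ℝ → ℝ} (hf : IsSob f f') (hP : Continuous P)
    {K : ℝ} (hK : ∀ x, |P x| ≤ K) :
    Integrable (fun x => f' x ^ 2 + P x * f x ^ 2) volume := by
  refine hf.integrable_sq'.add ?_
  have := integrable_mul_L2 (memLp_bdd_mul hf.memLp hP hK) hf.memLp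
  refine this.congr (Eventually.of_forall fun x => ?_)
  simp only
  ring

/-- The Riccati inequality on a half-line, for a bounded supersolution and a function vanishing at
the end point. -/
theorem IsSob.riccati_Ioi {f f' g g' P : ℝ → ℝ} {p δ K L : ℝ} (hf : IsSob f f')
    (hP : Continuous P) (hK : ∀ x, |P x| ≤ K) (hg : ContDiffOn ℝ 1 g (Ici p))
    (hg' : ∀ x ∈ Ioi p, HasDerivAt g (g' x) x)
    (hL : ∀ x ∈ Ioi p, |g x| ≤ L)
    (hR : ∀ x ∈ Ioi p, g' x + g x ^ 2 + δ ≤ P x) (h0 : f p = 0) :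
    0 ≤ ∫ x in Ioi p, (f' x ^ 2 + P x * f x ^ 2 - δ * f x ^ 2) := by
  have hi : Integrable (fun x => f' x ^ 2 + P x * f x ^ 2 - δ * f x ^ 2) volume :=
    (hf.integrable_energy hP hK).sub (hf.integrable_sq.const_mul δ)
  have h1 := intervalIntegral_tendsto_integral_Ioi p hi.integrableOn tendsto_id
  have h2 : Tendsto (fun b => -(L * (f b * f b))) atTop (𝓝 0) := by
    simpa using ((hf.tendsto_mul_atTop hf).const_mul L).neg
  refine le_of_tendsto_of_tendsto h2 h1 ?_
  filter_upwards [eventually_gt_atTop p] with b hb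
  have h3 := hf.riccati hb.le hP (hg.mono Icc_subset_Ici_self) (fun x hx => hg' x hx.1)
    (fun x hx => hR x hx.1)
  rw [h0] at h3
  refine le_trans ?_ h3
  have h4 := (abs_le.1 (hL b hb)).1
  nlinarith [mul_nonneg (sub_nonneg.2 h4) (sq_nonneg (f b))]

/-- The Riccati inequality on `[0, b]` for a function vanishing at both end points; the
supersolution may blow up like `1 / x` at the origin. -/
theorem IsSob.riccati_singular {f f' g g' P : ℝ → ℝ} {b δ L : ℝ} (hf : IsSob f f') (hb : 0 < b)
    (hP : Continuous P) (hg : ContDiffOn ℝ 1 g (Ioc 0 b))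
    (hg' : ∀ x ∈ Ioo 0 b, HasDerivAt g (g' x) x)
    (hL : ∀ x ∈ Ioo 0 b, g x ≤ L / x)
    (hR : ∀ x ∈ Ioo 0 b, g' x + g x ^ 2 + δ ≤ P x) (h0 : f 0 = 0) (hfb : f b = 0) :
    0 ≤ ∫ x in (0 : ℝ)..b, (f' x ^ 2 + P x * f x ^ 2 - δ * f x ^ 2) := by
  have i1 : ∀ c d, IntervalIntegrable (fun x => f' x ^ 2) volume c d := fun _ _ =>
    hf.integrable_sq'.intervalIntegrable
  have i2 : ∀ c d, IntervalIntegrable (fun x => f' x ^ 2 + P x * f x ^ 2 - δ * f x ^ 2)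
      volume c d := fun c d =>
    ((i1 c d).add ((hP.mul (hf.continuous.pow 2)).intervalIntegrable _ _)).sub
      ((continuous_const.mul (hf.continuous.pow 2)).intervalIntegrable _ _)
  have c1 := intervalIntegral.continuous_primitive i1 0
  have c2 := intervalIntegral.continuous_primitive i2 0
  have h1 : Tendsto (fun t => -(|L| * ∫ x in (0 : ℝ)..t, f' x ^ 2)) (𝓝[>] 0) (𝓝 0) := by
    have : Tendsto (fun t => -(|L| * ∫ x in (0 : ℝ)..t, f' x ^ 2)) (𝓝 0)
        (𝓝 (-(|L| * ∫ x in (0 : ℝ)..0, f' x ^ 2))) :=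
      ((continuous_const.mul c1).neg).tendsto 0
    simp only [intervalIntegral.integral_same, mul_zero, neg_zero] at this
    exact this.mono_left nhdsWithin_le_nhds
  have h2 : Tendsto (fun t => ∫ x in t..b, (f' x ^ 2 + P x * f x ^ 2 - δ * f x ^ 2)) (𝓝[>] 0)
      (𝓝 (∫ x in (0 : ℝ)..b, (f' x ^ 2 + P x * f x ^ 2 - δ * f x ^ 2))) := by
    have e : (fun t => ∫ x in t..b, (f' x ^ 2 + P x * f x ^ 2 - δ * f x ^ 2))
        = fun t => (∫ x in (0 : ℝ)..b, (f' x ^ 2 + P x * f x ^ 2 - δ * f x ^ 2))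
          - ∫ x in (0 : ℝ)..t, (f' x ^ 2 + P x * f x ^ 2 - δ * f x ^ 2) := by
      funext t
      rw [intervalIntegral.integral_interval_sub_left (i2 0 b) (i2 0 t)]
    have h := (c2.tendsto 0).const_sub
      (∫ x in (0 : ℝ)..b, (f' x ^ 2 + P x * f x ^ 2 - δ * f x ^ 2))
    rw [intervalIntegral.integral_same, sub_zero] at h
    rw [e]
    exact h.mono_left nhdsWithin_le_nhds
  refine le_of_tendsto_of_tendsto h1 h2 ?_
  filter_upwards [Ioo_mem_nhdsGT hb] with t ht
  have h3 := hf.riccati ht.2.le hP (hg.mono fun x hx => ⟨ht.1.trans_le hx.1, hx.2⟩)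
    (fun x hx => hg' x ⟨ht.1.trans hx.1, hx.2⟩) (fun x hx => hR x ⟨ht.1.trans hx.1, hx.2⟩)
  rw [hfb] at h3
  refine le_trans ?_ h3
  have h4 := hf.sq_le_mul_integral ht.1.le h0
  have h5 : g t * f t ^ 2 ≤ |L| / t * f t ^ 2 :=
    mul_le_mul_of_nonneg_right ((hL t ht).trans
      (div_le_div_of_nonneg_right (le_abs_self L) ht.1.le)) (sq_nonneg _)
  have h6 : |L| / t * f t ^ 2 ≤ |L| / t * (t * ∫ x in (0 : ℝ)..t, f' x ^ 2) :=
    mul_le_mul_of_nonneg_left h4 (div_nonneg (abs_nonneg _) ht.1.le)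
  have h7 : |L| / t * (t * ∫ x in (0 : ℝ)..t, f' x ^ 2) = |L| * ∫ x in (0 : ℝ)..t, f' x ^ 2 := by
    field_simp [ht.1.ne']
  linarith

end DNLS

/-! ### The normalised profile -/

namespace DNLS

open Filter Topology Set

/-- The function `1 / (cosh y - a)`, the square of the normalised profile. -/
noncomputable def profR (a y : ℝ) : ℝ := (Real.cosh y - a)⁻¹

/-- The function `sinh y / (cosh y - a)`, which is `-2` times the logarithmic derivative of the
normalised profile. -/
noncomputable def profT (a y : ℝ) : ℝ := Real.sinh y * profR a y

/-- The profile `(cosh y - a)^{-1/2}`, that is, `φ` in the variable `y = √(4ω - c²) x`, with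
`a = c / (2 √ω)` and amplitude one. -/
noncomputable def prof (a y : ℝ) : ℝ := √(profR a y)

/-- The derivative of the profile. -/
noncomputable def prof' (a y : ℝ) : ℝ := -(1 / 2) * profT a y * prof a y

/-- The potential of `L₊` in normalised variables; it satisfies `(∂² - pPlus) prof' = 0`. -/
noncomputable def pPlus (a y : ℝ) : ℝ :=
  1 / 4 + 3 * a * profR a y - 15 / 4 * (1 - a ^ 2) * profR a y ^ 2

/-- The potential of `L₋` in normalised variables; it satisfies `(∂² - pMinus) prof = 0`. -/
noncomputable def pMinus (a y : ℝ) : ℝ :=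
  1 / 4 + a * profR a y - 3 / 4 * (1 - a ^ 2) * profR a y ^ 2

section parity

variable (a y : ℝ)

theorem profR_neg : profR a (-y) = profR a y := by simp [profR]

theorem profT_neg : profT a (-y) = -profT a y := by simp [profT, profR_neg]

theorem prof_neg : prof a (-y) = prof a y := by simp [prof, profR_neg]

theorem prof'_neg : prof' a (-y) = -prof' a y := by simp [prof', profT_neg, prof_neg]

theorem pPlus_neg : pPlus a (-y) = pPlus a y := by simp [pPlus, profR_neg]

theorem pMinus_neg : pMinus a (-y) = pMinus a y := by simp [pMinus, profR_neg]

theorem prof'_zero : prof' a 0 = 0 := by simp [prof', profT]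

end parity

variable {a : ℝ}

theorem profDen_pos (ha : |a| < 1) (y : ℝ) : 0 < Real.cosh y - a := by
  linarith [Real.one_le_cosh y, le_abs_self a]

theorem profR_pos (ha : |a| < 1) (y : ℝ) : 0 < profR a y := inv_pos.2 (profDen_pos ha y)

theorem prof_pos (ha : |a| < 1) (y : ℝ) : 0 < prof a y := Real.sqrt_pos.2 (profR_pos ha y)

theorem prof_sq (ha : |a| < 1) (y : ℝ) : prof a y ^ 2 = profR a y :=
  Real.sq_sqrt (profR_pos ha y).le

theorem profT_pos (ha : |a| < 1) {y : ℝ} (hy : 0 < y) : 0 < profT a y :=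
  mul_pos (Real.sinh_pos_iff.2 hy) (profR_pos ha y)

theorem cosh_mul_profR (ha : |a| < 1) (y : ℝ) : Real.cosh y * profR a y = 1 + a * profR a y := by
  have := (profDen_pos ha y).ne'
  rw [profR]
  field_simp
  ring

theorem profT_sq (ha : |a| < 1) (y : ℝ) :
    profT a y ^ 2 = 1 + 2 * a * profR a y - (1 - a ^ 2) * profR a y ^ 2 := by
  rw [profT, mul_pow, Real.sinh_sq, sub_mul, ← mul_pow, cosh_mul_profR ha]
  ring

theorem hasDerivAt_profR (ha : |a| < 1) (y : ℝ) :
    HasDerivAt (profR a) (-(profT a y * profR a y)) y := by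
  have h := ((Real.hasDerivAt_cosh y).sub_const a).inv (profDen_pos ha y).ne'
  refine h.congr_deriv ?_
  rw [profT, profR]
  field_simp

theorem hasDerivAt_profT (ha : |a| < 1) (y : ℝ) :
    HasDerivAt (profT a) ((1 - a ^ 2) * profR a y ^ 2 - a * profR a y) y := by
  have h := (Real.hasDerivAt_sinh y).mul (hasDerivAt_profR ha y)
  refine h.congr_deriv ?_
  rw [cosh_mul_profR ha]
  have h2 := profT_sq ha y
  have h3 : Real.sinh y * -(profT a y * profR a y) = -(profT a y ^ 2) := by
    rw [profT]; ring
  rw [h3, h2]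
  ring

theorem hasDerivAt_prof (ha : |a| < 1) (y : ℝ) : HasDerivAt (prof a) (prof' a y) y := by
  have h := (hasDerivAt_profR ha y).sqrt (profR_pos ha y).ne'
  refine h.congr_deriv ?_
  have h1 : profR a y = prof a y ^ 2 := (prof_sq ha y).symm
  have h2 := (prof_pos ha y).ne'
  rw [prof', show √(profR a y) = prof a y from rfl, h1]
  field_simp

theorem continuous_profR (ha : |a| < 1) : Continuous (profR a) :=
  continuous_iff_continuousAt.2 fun y => (hasDerivAt_profR ha y).continuousAt

theorem continuous_profT (ha : |a| < 1) : Continuous (profT a) :=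
  continuous_iff_continuousAt.2 fun y => (hasDerivAt_profT ha y).continuousAt

theorem continuous_prof (ha : |a| < 1) : Continuous (prof a) :=
  continuous_iff_continuousAt.2 fun y => (hasDerivAt_prof ha y).continuousAt

theorem bdd_profR (ha : |a| < 1) : ∃ K, ∀ y, |profR a y| ≤ K := by
  refine ⟨(1 - a)⁻¹, fun y => ?_⟩
  rw [abs_of_pos (profR_pos ha y)]
  exact inv_anti₀ (by linarith [le_abs_self a]) (by linarith [Real.one_le_cosh y])

theorem bdd_profT (ha : |a| < 1) : ∃ K, ∀ y, |profT a y| ≤ K := by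
  obtain ⟨K, hK⟩ := bdd_profR ha
  refine ⟨2 + 2 * K, fun y => ?_⟩
  have h1 := profT_sq ha y
  have h2 := hK y
  have h3 : 0 ≤ (1 - a ^ 2) * profR a y ^ 2 :=
    mul_nonneg (by nlinarith [abs_lt.1 ha, sq_abs a, abs_nonneg a]) (sq_nonneg _)
  have h4 : a * profR a y ≤ K := by
    calc a * profR a y ≤ |a * profR a y| := le_abs_self _
      _ = |a| * |profR a y| := abs_mul _ _
      _ ≤ 1 * K := mul_le_mul ha.le h2 (abs_nonneg _) zero_le_one
      _ = K := one_mul K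
  nlinarith [sq_nonneg (|profT a y| - 1), sq_abs (profT a y)]

theorem isBddC1_profR (ha : |a| < 1) :
    IsBddC1 (profR a) (fun y => -(profT a y * profR a y)) := by
  refine ⟨hasDerivAt_profR ha, ((continuous_profT ha).mul (continuous_profR ha)).neg,
    bdd_profR ha, ?_⟩
  simpa only [abs_neg] using bdd_mul (bdd_profT ha) (bdd_profR ha)

theorem isBddC1_profT (ha : |a| < 1) :
    IsBddC1 (profT a) (fun y => (1 - a ^ 2) * profR a y ^ 2 - a * profR a y) := by
  have hb := (((isBddC1_profR ha).mul (isBddC1_profR ha)).const_mul (1 - a ^ 2)).add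
    ((isBddC1_profR ha).const_mul (-a))
  have e : (fun y => (1 - a ^ 2) * profR a y ^ 2 - a * profR a y)
      = fun y => (1 - a ^ 2) * (profR a y * profR a y) + -a * profR a y := by
    funext y; ring
  rw [e]
  exact ⟨fun y => by simpa only [← congrFun e y] using hasDerivAt_profT ha y, hb.continuous,
    bdd_profT ha, hb.bdd⟩

theorem isBddC1_pMinus (ha : |a| < 1) : IsBddC1 (pMinus a)
    (fun y => profT a y * (-a * profR a y + 3 / 2 * (1 - a ^ 2) * profR a y ^ 2)) := by
  have h := ((IsBddC1.const (1 / 4)).add ((isBddC1_profR ha).const_mul a)).add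
    (((isBddC1_profR ha).mul (isBddC1_profR ha)).const_mul (-(3 / 4) * (1 - a ^ 2)))
  convert h using 1
  · funext y; rw [pMinus]; ring
  · funext y; ring

theorem isBddC1_pPlus (ha : |a| < 1) : IsBddC1 (pPlus a)
    (fun y => profT a y * (-3 * a * profR a y + 15 / 2 * (1 - a ^ 2) * profR a y ^ 2)) := by
  have h := ((IsBddC1.const (1 / 4)).add ((isBddC1_profR ha).const_mul (3 * a))).add
    (((isBddC1_profR ha).mul (isBddC1_profR ha)).const_mul (-(15 / 4) * (1 - a ^ 2)))
  convert h using 1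
  · funext y; rw [pPlus]; ring
  · funext y; ring

/-- Decay of the profile, in the form needed for `prof` and `y * prof` to be square integrable. -/
theorem profR_le (ha : |a| < 1) :
    ∃ K, ∀ y, (1 + y ^ 2) * profR a y ≤ K * (1 + y ^ 2)⁻¹ := by
  refine ⟨98 / (1 - |a|), fun y => ?_⟩
  have h1 : 0 < 1 - |a| := by linarith
  have h2 : (1 - |a|) * Real.cosh y ≤ Real.cosh y - a := by
    nlinarith [Real.one_le_cosh y, le_abs_self a, abs_nonneg a]
  have h3 : (1 + y ^ 2) ^ 2 ≤ 98 * Real.cosh y := by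
    have e1 : |y| ^ 4 / (4 : ℕ).factorial ≤ Real.exp |y| :=
      Real.pow_div_factorial_le_exp _ (abs_nonneg y) 4
    have e2 : Real.cosh y = (Real.exp |y| + Real.exp (-|y|)) / 2 := by
      rw [← Real.cosh_abs, Real.cosh_eq]
    have e3 := Real.exp_pos (-|y|)
    have e4 := Real.one_le_cosh y
    have e5 : |y| ^ 4 = y ^ 4 := by
      rw [show |y| ^ 4 = (|y| ^ 2) ^ 2 by ring, sq_abs]; ring
    rw [e5] at e1
    norm_num [Nat.factorial] at e1
    nlinarith [sq_nonneg (y ^ 2 - 1)]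
  have h4 : 0 < 1 + y ^ 2 := by positivity
  have h5 := profDen_pos ha y
  rw [profR, ← div_eq_mul_inv, ← div_eq_mul_inv, div_le_div_iff₀ h5 h4, div_mul_eq_mul_div,
    le_div_iff₀ h1]
  nlinarith

theorem integrable_one_add_sq_mul_profR (ha : |a| < 1) :
    Integrable (fun y => (1 + y ^ 2) * profR a y) volume := by
  obtain ⟨K, hK⟩ := profR_le ha
  refine (integrable_inv_one_add_sq.const_mul K).mono' (Continuous.aestronglyMeasurable
    ((by fun_prop : Continuous fun y : ℝ => 1 + y ^ 2).mul (continuous_profR ha)))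
    (Eventually.of_forall fun y => ?_)
  rw [Real.norm_eq_abs, abs_of_nonneg (mul_nonneg (by positivity) (profR_pos ha y).le)]
  exact hK y

theorem memLp_prof (ha : |a| < 1) : MemLp (prof a) 2 volume := by
  rw [memLp_two_iff_integrable_sq (continuous_prof ha).aestronglyMeasurable]
  refine (integrable_one_add_sq_mul_profR ha).mono'
    ((continuous_prof ha).pow 2).aestronglyMeasurable (Eventually.of_forall fun y => ?_)
  rw [Real.norm_eq_abs, abs_of_nonneg (sq_nonneg _), prof_sq ha]
  nlinarith [profR_pos ha y, mul_nonneg (sq_nonneg y) (profR_pos ha y).le]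

theorem memLp_id_mul_prof (ha : |a| < 1) : MemLp (fun y => y * prof a y) 2 volume := by
  have hc : Continuous fun y => y * prof a y := continuous_id.mul (continuous_prof ha)
  rw [memLp_two_iff_integrable_sq hc.aestronglyMeasurable]
  refine (integrable_one_add_sq_mul_profR ha).mono'
    (hc.pow 2).aestronglyMeasurable (Eventually.of_forall fun y => ?_)
  rw [Real.norm_eq_abs, abs_of_nonneg (sq_nonneg _), mul_pow, prof_sq ha]
  nlinarith [profR_pos ha y, mul_nonneg (sq_nonneg y) (profR_pos ha y).le]

theorem continuous_prof' (ha : |a| < 1) : Continuous (prof' a) :=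
  (continuous_const.mul (continuous_profT ha)).mul (continuous_prof ha)

theorem isSob_prof (ha : |a| < 1) : IsSob (prof a) (prof' a) := by
  obtain ⟨K, hK⟩ := ((isBddC1_profT ha).const_mul (-(1 / 2))).bdd
  exact ⟨memLp_prof ha, memLp_bdd_mul (memLp_prof ha) (continuous_const.mul (continuous_profT ha))
    hK, (IsPrim.of_hasDerivAt (hasDerivAt_prof ha) (continuous_prof' ha)).integral_eq⟩

theorem isSob_prof' (ha : |a| < 1) : IsSob (prof' a) (fun y => pMinus a y * prof a y) := by
  have h := (isSob_prof ha).bddC1_mul ((isBddC1_profT ha).const_mul (-(1 / 2)))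
  convert h using 1
  · funext y
    rw [prof']
  · funext y
    rw [prof', pMinus]
    linear_combination (-(1 / 4) * prof a y) * profT_sq ha y

theorem isSob_prof'' (ha : |a| < 1) :
    IsSob (fun y => pMinus a y * prof a y) (fun y => pPlus a y * prof' a y) := by
  have h := (isSob_prof ha).bddC1_mul (isBddC1_pMinus ha)
  convert h using 1
  funext y
  rw [prof', pMinus, pPlus]
  ring

theorem isSob_id_mul_prof (ha : |a| < 1) : IsSob (fun y => y * prof a y)
    (fun y => prof a y - 1 / 2 * profT a y * (y * prof a y)) := by
  obtain ⟨K, hK⟩ := ((isBddC1_profT ha).const_mul (1 / 2)).bdd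
  refine ⟨memLp_id_mul_prof ha, (memLp_prof ha).sub (memLp_bdd_mul (memLp_id_mul_prof ha)
    (continuous_const.mul (continuous_profT ha)) hK), (IsPrim.of_hasDerivAt (fun y => ?_)
    ?_).integral_eq⟩
  · refine ((hasDerivAt_id y).mul (hasDerivAt_prof ha y)).congr_deriv ?_
    rw [prof', id]
    ring
  · have h1 := continuous_prof ha
    have h2 := continuous_profT ha
    fun_prop

/-! ### The dual vector of the constraints -/

/-- The first component of the preimage `Ψ` of the constraint vector
`(½ prof + σ prof³, prof')` under the linearised operator, where `σ² = 1 - a²`. -/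
noncomputable def dualRe (a y : ℝ) : ℝ :=
  (1 / 2 * (√(1 - a ^ 2) * a - 1 - a ^ 2)
      + 1 / 2 * (1 - a ^ 2) * (a - √(1 - a ^ 2)) * profR a y) * prof a y
    + 1 / 2 * profT a y * (y * prof a y)

/-- The derivative of `dualRe`. -/
noncomputable def dualRe' (a y : ℝ) : ℝ :=
  ((1 / 2 - 1 / 4 * (√(1 - a ^ 2) * a - 1 - a ^ 2)) * profT a y
      - 3 / 4 * (1 - a ^ 2) * (a - √(1 - a ^ 2)) * (profT a y * profR a y)) * prof a y
    + -pMinus a y * (y * prof a y)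

/-- The second component of the preimage `Ψ` of the constraint vector. -/
noncomputable def dualIm (a y : ℝ) : ℝ := -(1 / 2) * (y * prof a y)

/-- The derivative of `dualIm`. -/
noncomputable def dualIm' (a y : ℝ) : ℝ :=
  -(1 / 2) * (prof a y - 1 / 2 * profT a y * (y * prof a y))

theorem isSob_dualRe (ha : |a| < 1) : IsSob (dualRe a) (dualRe' a) := by
  have h1 := (isSob_prof ha).bddC1_mul ((IsBddC1.const (1 / 2 * (√(1 - a ^ 2) * a - 1 - a ^ 2))).add
    ((isBddC1_profR ha).const_mul (1 / 2 * (1 - a ^ 2) * (a - √(1 - a ^ 2)))))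
  have h2 := (isSob_id_mul_prof ha).bddC1_mul ((isBddC1_profT ha).const_mul (1 / 2))
  convert h1.add h2 using 1
  · funext y
    rw [dualRe]
  · funext y
    rw [dualRe', prof', pMinus]
    linear_combination (1 / 4 * (y * prof a y)) * profT_sq ha y

/-- The equation `(-∂² + pPlus) dualRe = ½ prof + σ prof³`. -/
theorem isSob_dualRe' (ha : |a| < 1) : IsSob (dualRe' a)
    (fun y => pPlus a y * dualRe a y
      - (1 / 2 * prof a y + √(1 - a ^ 2) * (profR a y * prof a y))) := by
  have h1 := (isSob_prof ha).bddC1_mul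
    (((isBddC1_profT ha).const_mul (1 / 2 - 1 / 4 * (√(1 - a ^ 2) * a - 1 - a ^ 2))).add
    (((isBddC1_profT ha).mul (isBddC1_profR ha)).const_mul
      (-(3 / 4) * (1 - a ^ 2) * (a - √(1 - a ^ 2)))))
  have h2 := (isSob_id_mul_prof ha).bddC1_mul ((isBddC1_pMinus ha).const_mul (-1))
  convert h1.add h2 using 1
  · funext y
    rw [dualRe']
    ring
  · funext y
    rw [dualRe, prof', pMinus, pPlus]
    linear_combination ((1 / 2 * (1 / 2 - 1 / 4 * (√(1 - a ^ 2) * a - 1 - a ^ 2))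
      - 9 / 8 * (1 - a ^ 2) * (a - √(1 - a ^ 2)) * profR a y) * prof a y) * profT_sq ha y

theorem isSob_dualIm (ha : |a| < 1) : IsSob (dualIm a) (dualIm' a) :=
  (isSob_id_mul_prof ha).const_mul (-(1 / 2))

/-- The equation `(-∂² + pMinus) dualIm = prof'`. -/
theorem isSob_dualIm' (ha : |a| < 1) : IsSob (dualIm' a)
    (fun y => pMinus a y * dualIm a y - prof' a y) := by
  have h1 := ((isSob_prof ha).add
    ((isSob_id_mul_prof ha).bddC1_mul ((isBddC1_profT ha).const_mul (-(1 / 2))))).const_mul (-(1 / 2))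
  convert h1 using 1
  · funext y
    rw [dualIm']
    ring
  · funext y
    rw [dualIm, prof', pMinus]
    linear_combination (1 / 8 * (y * prof a y)) * profT_sq ha y

theorem sqrt_one_sub_sq_pos (ha : |a| < 1) : 0 < √(1 - a ^ 2) :=
  Real.sqrt_pos.2 (by nlinarith [sq_abs a, abs_nonneg a])

theorem sq_sqrt_one_sub_sq (ha : |a| < 1) : √(1 - a ^ 2) ^ 2 = 1 - a ^ 2 :=
  Real.sq_sqrt (by nlinarith [sq_abs a, abs_nonneg a])

theorem dualRe_zero_ne (ha : |a| < 1) : dualRe a 0 ≠ 0 := by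
  have h1 : profR a 0 * (1 - a) = 1 := by
    rw [profR, Real.cosh_zero, inv_mul_cancel₀]
    linarith [le_abs_self a]
  have h2 : dualRe a 0 = 1 / 2 * (a - 1 - √(1 - a ^ 2)) * prof a 0 := by
    rw [dualRe]
    linear_combination (1 / 2 * (1 + a) * (a - √(1 - a ^ 2)) * prof a 0) * h1
  rw [h2]
  refine mul_ne_zero (ne_of_lt ?_) (prof_pos ha 0).ne'
  linarith [sqrt_one_sub_sq_pos ha, le_abs_self a]

theorem dualRe_neg (y : ℝ) : dualRe a (-y) = dualRe a y := by
  rw [dualRe, dualRe, profR_neg, profT_neg, prof_neg]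
  ring

theorem dualIm_neg (y : ℝ) : dualIm a (-y) = -dualIm a y := by
  rw [dualIm, dualIm, prof_neg]
  ring

theorem tendsto_profR_atTop (ha : |a| < 1) : Tendsto (profR a) atTop (𝓝 0) := by
  have h := (isSob_prof ha).tendsto_mul_atTop (isSob_prof ha)
  refine h.congr fun y => ?_
  rw [← sq, prof_sq ha]

theorem tendsto_profT_atTop (ha : |a| < 1) : Tendsto (profT a) atTop (𝓝 1) := by
  have hR := tendsto_profR_atTop ha
  have h1 : Tendsto (fun y => √(1 + 2 * a * profR a y - (1 - a ^ 2) * profR a y ^ 2)) atTop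
      (𝓝 (√(1 + 2 * a * 0 - (1 - a ^ 2) * 0 ^ 2))) :=
    (((hR.const_mul (2 * a)).const_add 1).sub ((hR.pow 2).const_mul (1 - a ^ 2))).sqrt
  have h2 : √(1 + 2 * a * 0 - (1 - a ^ 2) * 0 ^ 2) = 1 := by simp
  rw [h2] at h1
  refine h1.congr' ?_
  filter_upwards [eventually_gt_atTop 0] with y hy
  rw [← profT_sq ha, Real.sqrt_sq (profT_pos ha hy).le]

theorem tendsto_id_mul_profR_atTop (ha : |a| < 1) :
    Tendsto (fun y => y * profR a y) atTop (𝓝 0) := by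
  have h := (isSob_id_mul_prof ha).tendsto_mul_atTop (isSob_prof ha)
  refine h.congr fun y => ?_
  rw [mul_assoc, ← sq, prof_sq ha]

/-- The linearised form at `Ψ` is negative: the integrand is the derivative of an odd function which
tends to `-σ / 2` at `+∞`. -/
theorem integral_dual (ha : |a| < 1) :
    (∫ y, dualRe a y * (1 / 2 * prof a y + √(1 - a ^ 2) * (profR a y * prof a y)))
      + (∫ y, dualIm a y * prof' a y) = -√(1 - a ^ 2) := by
  set σ := √(1 - a ^ 2) with hσ
  have hs : σ ^ 2 = 1 - a ^ 2 := sq_sqrt_one_sub_sq ha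
  obtain ⟨K, hK⟩ := bdd_profR ha
  have m1 : MemLp (fun y => 1 / 2 * prof a y + σ * (profR a y * prof a y)) 2 volume :=
    ((memLp_prof ha).const_mul _).add
      ((memLp_bdd_mul (memLp_prof ha) (continuous_profR ha) hK).const_mul _)
  have i1 := integrable_mul_L2 (isSob_dualRe ha).memLp m1
  have i2 := integrable_mul_L2 (isSob_dualIm ha).memLp (isSob_prof' ha).memLp
  rw [← integral_add i1 i2]
  set F : ℝ → ℝ := fun y => -(1 / 2) * (y * profR a y) - 1 / 4 * σ * (y * profR a y * profR a y)
    - 1 / 2 * σ * profT a y + 1 / 4 * σ * (a - σ) * (profT a y * profR a y) with hF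
  have hd : ∀ y, HasDerivAt F
      (dualRe a y * (1 / 2 * prof a y + σ * (profR a y * prof a y)) + dualIm a y * prof' a y) y := by
    intro y
    have hR := hasDerivAt_profR ha y
    have hT := hasDerivAt_profT ha y
    have hy := (hasDerivAt_id y).mul hR
    have h := (((hy.const_mul (-(1 / 2))).sub ((hy.mul hR).const_mul (1 / 4 * σ))).sub
      (hT.const_mul (1 / 2 * σ))).add ((hT.mul hR).const_mul (1 / 4 * σ * (a - σ)))
    refine h.congr_deriv ?_
    have h1 := prof_sq ha y
    have h2 := profT_sq ha y
    simp only [Pi.mul_apply, id]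
    have e : dualRe a y * (1 / 2 * prof a y + σ * (profR a y * prof a y)) + dualIm a y * prof' a y
        = ((1 / 2 * (σ * a - 1 - a ^ 2) + 1 / 2 * (1 - a ^ 2) * (a - σ) * profR a y
          + 1 / 2 * profT a y * y) * (1 / 2 + σ * profR a y) + 1 / 4 * y * profT a y)
          * profR a y := by
      rw [dualRe, dualIm, prof', ← hσ, ← h1]
      ring
    rw [e]
    ring_nf at h2 ⊢
    simp only [h2]
    ring_nf
    simp only [hs]
    ring
  have hF0 : ∀ y, F y = -F (-y) := by
    intro y
    simp only [hF, profR_neg, profT_neg]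
    ring
  have hR := tendsto_profR_atTop ha
  have hT := tendsto_profT_atTop ha
  have hy := tendsto_id_mul_profR_atTop ha
  have ht : Tendsto F atTop (𝓝 (-(1 / 2) * σ)) := by
    have h := (((hy.const_mul (-(1 / 2))).sub ((hy.mul hR).const_mul (1 / 4 * σ))).sub
      (hT.const_mul (1 / 2 * σ))).add ((hT.mul hR).const_mul (1 / 4 * σ * (a - σ)))
    convert h using 2
    ring
  have hb : Tendsto F atBot (𝓝 (1 / 2 * σ)) := by
    have h := (ht.comp tendsto_neg_atBot_atTop).neg
    refine (h.congr fun y => (hF0 y).symm).trans_eq ?_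
    congr 1
    ring
  rw [integral_of_hasDerivAt_of_tendsto hd (i1.add i2) hb ht]
  ring

end DNLS

/-! ### Estimates on the half-line -/

namespace DNLS

open Filter Topology Set

theorem IsBddC1.contDiff {g g' : ℝ → ℝ} (hg : IsBddC1 g g') : ContDiff ℝ 1 g := by
  rw [contDiff_one_iff_deriv]
  refine ⟨fun x => (hg.hasDerivAt x).differentiableAt, ?_⟩
  rw [show deriv g = g' from funext fun x => (hg.hasDerivAt x).deriv]
  exact hg.continuous'

variable {a : ℝ}

theorem cosh_mul_exp_neg (y : ℝ) : 2 * Real.cosh y * Real.exp (-y) = 1 + Real.exp (-y) ^ 2 := by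
  have h : Real.exp y * Real.exp (-y) = 1 := by rw [← Real.exp_add]; simp
  rw [Real.cosh_eq]
  linear_combination h

theorem hasDerivAt_exp_neg (y : ℝ) : HasDerivAt (fun y => Real.exp (-y)) (-Real.exp (-y)) y := by
  simpa using (hasDerivAt_neg y).exp

theorem le_profT (ha : |a| < 1) {y : ℝ} (hy : 0 < y) :
    1 / 4 * (1 - Real.exp (-y) ^ 2) ≤ profT a y := by
  have hD := profDen_pos ha y
  have hq := Real.exp_pos (-y)
  have hq1 : Real.exp (-y) < 1 := Real.exp_lt_one_iff.2 (by linarith)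
  have hC := Real.one_le_cosh y
  have h1 := cosh_mul_exp_neg y
  have h2 : Real.sinh y = Real.cosh y - Real.exp (-y) := by rw [← Real.cosh_sub_sinh]; ring
  rw [profT, profR, ← div_eq_mul_inv, le_div_iff₀ hD, h2]
  have h3 : Real.cosh y - a ≤ 2 * Real.cosh y := by linarith [neg_abs_le a]
  have h4 : 1 / 4 * (1 - Real.exp (-y) ^ 2) * (Real.cosh y - a)
      ≤ 1 / 4 * (1 - Real.exp (-y) ^ 2) * (2 * Real.cosh y) :=
    mul_le_mul_of_nonneg_left h3 (by nlinarith)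
  have h5 : Real.exp (-y) ^ 2 * Real.cosh y = Real.exp (-y) * (1 + Real.exp (-y) ^ 2) / 2 := by
    rw [← h1]; ring
  nlinarith

/-- Coercivity of `L₋` on functions vanishing at the origin: the logarithmic derivative
`-profT / 2` of the profile solves the Riccati equation, and is perturbed by a small decreasing
function. -/
theorem IsSob.half_line_minus {f f' : ℝ → ℝ} (ha : |a| < 1) (hf : IsSob f f') (h0 : f 0 = 0) :
    0 ≤ ∫ y in Ioi (0 : ℝ), (f' y ^ 2 + pMinus a y * f y ^ 2 - 1 / 256 * f y ^ 2) := by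
  obtain ⟨K, hK⟩ := (isBddC1_pMinus ha).bdd
  obtain ⟨L, hL⟩ := (isBddC1_profT ha).bdd
  -- With `q = exp (-y)`, the perturbation `(1 + q) / 32` gains
  -- `(q + (1 + q) profT - (1 + q)² / 32) / 32`, where `q + (1 + q) profT ≥ 1 / 4` and `q ≤ 1`.
  refine hf.riccati_Ioi (g := fun y => -(1 / 2) * profT a y + 1 / 32 * (1 + Real.exp (-y)))
    (g' := fun y => -(1 / 2) * ((1 - a ^ 2) * profR a y ^ 2 - a * profR a y)
      + 1 / 32 * -Real.exp (-y)) (L := 1 / 2 * L + 1 / 16)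
    (isBddC1_pMinus ha).continuous hK ?_ (fun y _ => ?_) (fun y hy => ?_) (fun y hy => ?_) h0
  · refine ContDiff.contDiffOn ?_
    exact (contDiff_const.mul (isBddC1_profT ha).contDiff).add (by fun_prop)
  · exact ((hasDerivAt_profT ha y).const_mul _).add (((hasDerivAt_exp_neg y).const_add 1).const_mul _)
  · have h1 := abs_le.1 (hL y)
    have hq := Real.exp_pos (-y)
    have hq1 : Real.exp (-y) < 1 := Real.exp_lt_one_iff.2 (by linarith [mem_Ioi.1 hy])
    rw [abs_le]
    constructor <;> linarith
  · have hT := le_profT ha (mem_Ioi.1 hy)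
    have hq := Real.exp_pos (-y)
    have hq1 : Real.exp (-y) < 1 := Real.exp_lt_one_iff.2 (by linarith [mem_Ioi.1 hy])
    have h2 := profT_sq ha y
    have hT0 := profT_pos ha (mem_Ioi.1 hy)
    have h3 : 1 / 4 ≤ Real.exp (-y) + profT a y * (1 + Real.exp (-y)) := by nlinarith
    simp only [pMinus]
    nlinarith

/-- The logarithmic derivative of `prof'`, which is singular at the origin. -/
noncomputable def logDerivProf' (a y : ℝ) : ℝ :=
  Real.cosh y / Real.sinh y - 3 / 2 * profT a y

/-- The Riccati equation for `logDerivProf'`. -/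
theorem hasDerivAt_logDerivProf' (ha : |a| < 1) {y : ℝ} (hy : 0 < y) :
    HasDerivAt (logDerivProf' a) (pPlus a y - logDerivProf' a y ^ 2) y := by
  have hS := (Real.sinh_pos_iff.2 hy).ne'
  have h := ((Real.hasDerivAt_cosh y).div (Real.hasDerivAt_sinh y) hS).sub
    ((hasDerivAt_profT ha y).const_mul (3 / 2))
  refine h.congr_deriv ?_
  have h1 : Real.cosh y / Real.sinh y * profT a y = 1 + a * profR a y := by
    rw [profT, ← cosh_mul_profR ha y]
    field_simp
  have h2 : (Real.sinh y * Real.sinh y - Real.cosh y * Real.cosh y) / Real.sinh y ^ 2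
      = 1 - (Real.cosh y / Real.sinh y) ^ 2 := by
    field_simp
  rw [h2, logDerivProf', pPlus]
  linear_combination (9 / 4) * profT_sq ha y - 3 * h1

theorem contDiffOn_logDerivProf' (ha : |a| < 1) : ContDiffOn ℝ 1 (logDerivProf' a) (Ioi 0) := by
  refine ContDiffOn.sub ?_ (contDiff_const.mul (isBddC1_profT ha).contDiff).contDiffOn
  exact Real.contDiff_cosh.contDiffOn.div Real.contDiff_sinh.contDiffOn fun y hy =>
    (Real.sinh_pos_iff.2 hy).ne'

theorem logDerivProf'_eq (ha : |a| < 1) {y : ℝ} (hy : 0 < y) : -2 * logDerivProf' a y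
    = (Real.cosh y ^ 2 + 2 * a * Real.cosh y - 3) / (Real.sinh y * (Real.cosh y - a)) := by
  have hS := (Real.sinh_pos_iff.2 hy).ne'
  have hD := (profDen_pos ha y).ne'
  rw [logDerivProf', profT, profR]
  field_simp
  rw [Real.sinh_sq]
  ring

/-- The profile has an inflection point, which depends only on `a`. -/
theorem exists_inflection (ha : |a| < 1) : ∃ b : ℝ, 0 < b ∧ Real.cosh b < 3 ∧
    Real.cosh b ^ 2 + 2 * a * Real.cosh b = 3 := by
  have h1 := abs_lt.1 ha
  have hs : √(a ^ 2 + 3) ^ 2 = a ^ 2 + 3 := Real.sq_sqrt (by positivity)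
  have hs0 := Real.sqrt_nonneg (a ^ 2 + 3)
  have h2 : 1 < √(a ^ 2 + 3) - a := by nlinarith
  have h3 : √(a ^ 2 + 3) - a < 3 := by nlinarith
  refine ⟨Real.arcosh (√(a ^ 2 + 3) - a), Real.arcosh_pos h2, ?_, ?_⟩
  · rwa [Real.cosh_arcosh h2.le]
  · rw [Real.cosh_arcosh h2.le]
    linear_combination hs

/-- Positivity of `L₊` beyond the inflection point, where the logarithmic derivative of `prof'` is
negative. -/
theorem IsSob.half_line_plus_outer {f f' : ℝ → ℝ} {b : ℝ} (ha : |a| < 1) (hb : 0 < b)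
    (hb3 : Real.cosh b < 3) (hbe : Real.cosh b ^ 2 + 2 * a * Real.cosh b = 3)
    (hf : IsSob f f') (h0 : f b = 0) :
    0 ≤ ∫ y in Ioi b, (f' y ^ 2 + pPlus a y * f y ^ 2 - 1 / 576 * f y ^ 2) := by
  obtain ⟨K, hK⟩ := (isBddC1_pPlus ha).bdd
  obtain ⟨L, hL⟩ := (isBddC1_profT ha).bdd
  have hSb := Real.sinh_pos_iff.2 hb
  -- The perturbation `(1 + q) / 48`, `q = exp (-y)`, gains `1 / 576` since
  -- `q - 2 (1 + q) logDerivProf' ≥ 1 / 6`: the first term dominates near `b`, the second far away.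
  refine hf.riccati_Ioi (g := fun y => logDerivProf' a y + 1 / 48 * (1 + Real.exp (-y)))
    (g' := fun y => pPlus a y - logDerivProf' a y ^ 2 + 1 / 48 * -Real.exp (-y))
    (L := 1 + 1 / Real.sinh b + 3 / 2 * L + 1 / 24)
    (isBddC1_pPlus ha).continuous hK ?_ (fun y hy => ?_) (fun y hy => ?_) (fun y hy => ?_) h0
  · exact ((contDiffOn_logDerivProf' ha).mono fun y hy => hb.trans_le hy).add
      (ContDiff.contDiffOn (by fun_prop))
  · exact (hasDerivAt_logDerivProf' ha (hb.trans hy)).add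
      (((hasDerivAt_exp_neg y).const_add 1).const_mul _)
  · have hy0 : 0 < y := hb.trans hy
    have h1 := abs_le.1 (hL y)
    have hq := Real.exp_pos (-y)
    have hq1 : Real.exp (-y) < 1 := Real.exp_lt_one_iff.2 (by linarith)
    have hS := Real.sinh_pos_iff.2 hy0
    have h2 : Real.cosh y = Real.sinh y + Real.exp (-y) := by rw [← Real.cosh_sub_sinh]; ring
    have h3 : Real.cosh y / Real.sinh y ≤ 1 + 1 / Real.sinh b := by
      have : 1 / Real.sinh y ≤ 1 / Real.sinh b :=
        one_div_le_one_div_of_le hSb (Real.sinh_le_sinh.2 hy.le)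
      calc Real.cosh y / Real.sinh y ≤ (Real.sinh y + 1) / Real.sinh y := by
            gcongr
            linarith
        _ = 1 + 1 / Real.sinh y := by field_simp
        _ ≤ _ := by linarith
    have h4 : 0 < Real.cosh y / Real.sinh y := div_pos (Real.cosh_pos y) hS
    simp only [logDerivProf']
    rw [abs_le]
    constructor <;> linarith
  · have hy0 : 0 < y := hb.trans hy
    have hq := Real.exp_pos (-y)
    have hq1 : Real.exp (-y) < 1 := Real.exp_lt_one_iff.2 (by linarith)
    have hC := Real.cosh_pos y
    have hS := Real.sinh_pos_iff.2 hy0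
    have hD := profDen_pos ha y
    have hCb := Real.one_le_cosh b
    have hCC : Real.cosh b ≤ Real.cosh y := by
      rw [Real.cosh_le_cosh, abs_of_pos hb, abs_of_pos hy0]
      exact (mem_Ioi.1 hy).le
    -- The numerator of `-2 logDerivProf'` factors, one factor being at least `cosh y`.
    have hN : (Real.cosh y - Real.cosh b) * Real.cosh y
        ≤ Real.cosh y ^ 2 + 2 * a * Real.cosh y - 3 := by
      have e : Real.cosh y ^ 2 + 2 * a * Real.cosh y - 3
          = (Real.cosh y - Real.cosh b) * (Real.cosh y + (Real.cosh b + 2 * a)) := by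
        linear_combination hbe
      have h1 : 0 < Real.cosh b + 2 * a := by
        by_contra hcon
        nlinarith
      rw [e]
      exact mul_le_mul_of_nonneg_left (by linarith) (by linarith)
    have hSD : Real.sinh y * (Real.cosh y - a) ≤ Real.cosh y * (2 * Real.cosh y) :=
      mul_le_mul (Real.sinh_lt_cosh y).le
        (by linarith [Real.one_le_cosh y, neg_abs_le a]) hD.le hC.le
    have hV : (Real.cosh y - Real.cosh b) / (2 * Real.cosh y) ≤ -2 * logDerivProf' a y := by
      rw [logDerivProf'_eq ha hy0]
      calc (Real.cosh y - Real.cosh b) / (2 * Real.cosh y)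
          = (Real.cosh y - Real.cosh b) * Real.cosh y / (Real.cosh y * (2 * Real.cosh y)) := by
            field_simp
        _ ≤ (Real.cosh y - Real.cosh b) * Real.cosh y / (Real.sinh y * (Real.cosh y - a)) :=
            div_le_div_of_nonneg_left (mul_nonneg (by linarith) hC.le) (mul_pos hS hD) hSD
        _ ≤ _ := by gcongr
    have hq2 : 1 / (2 * Real.cosh y) ≤ Real.exp (-y) := by
      rw [div_le_iff₀ (by positivity)]
      nlinarith [cosh_mul_exp_neg y]
    have h6 : 1 / 6 ≤ (1 + (Real.cosh y - Real.cosh b)) / (2 * Real.cosh y) := by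
      rw [div_le_div_iff₀ (by norm_num) (by positivity)]
      linarith
    rw [add_div] at h6
    have hV0 : 0 ≤ -2 * logDerivProf' a y :=
      le_trans (div_nonneg (by linarith) (by positivity)) hV
    have h7 : 1 / 6 ≤ Real.exp (-y) + -2 * logDerivProf' a y * (1 + Real.exp (-y)) := by
      nlinarith [mul_nonneg hV0 hq.le]
    nlinarith

/-- Positivity of `L₊` between the origin and the inflection point, where the logarithmic derivative
of `prof'` is positive. -/
theorem IsSob.half_line_plus_inner {f f' : ℝ → ℝ} {b : ℝ} (ha : |a| < 1) (hb : 0 < b)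
    (hb3 : Real.cosh b < 3) (hbe : Real.cosh b ^ 2 + 2 * a * Real.cosh b = 3)
    (hf : IsSob f f') (h0 : f 0 = 0) (hfb : f b = 0) :
    0 ≤ ∫ y in (0 : ℝ)..b, (f' y ^ 2 + pPlus a y * f y ^ 2 - 1 / 576 * f y ^ 2) := by
  -- The gain `(cosh + 2 sinh logDerivProf' - sinh² / 16) / 16` is at least `1 / 32`, as `sinh² ≤ 8`.
  refine hf.riccati_singular (g := fun y => logDerivProf' a y - 1 / 16 * Real.sinh y)
    (g' := fun y => pPlus a y - logDerivProf' a y ^ 2 - 1 / 16 * Real.cosh y) (L := 3)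
    hb (isBddC1_pPlus ha).continuous ?_ (fun y hy => ?_) (fun y hy => ?_) (fun y hy => ?_) h0 hfb
  · exact ((contDiffOn_logDerivProf' ha).mono fun y hy => hy.1).sub
      (contDiff_const.mul Real.contDiff_sinh).contDiffOn
  · exact (hasDerivAt_logDerivProf' ha hy.1).sub ((Real.hasDerivAt_sinh y).const_mul _)
  · have hS := Real.sinh_pos_iff.2 hy.1
    have hCC : Real.cosh y ≤ Real.cosh b := by
      rw [Real.cosh_le_cosh, abs_of_pos hb, abs_of_pos hy.1]
      exact hy.2.le
    have h1 : Real.cosh y / Real.sinh y ≤ 3 / y := by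
      have := Real.self_le_sinh_iff.2 hy.1.le
      exact div_le_div₀ (by norm_num) (by linarith) hy.1 this
    simp only [logDerivProf']
    linarith [profT_pos ha hy.1]
  · have hS := Real.sinh_pos_iff.2 hy.1
    have hD := profDen_pos ha y
    have hC := Real.one_le_cosh y
    have hCb := Real.one_le_cosh b
    have hCC : Real.cosh y ≤ Real.cosh b := by
      rw [Real.cosh_le_cosh, abs_of_pos hb, abs_of_pos hy.1]
      exact hy.2.le
    have hV : 0 ≤ logDerivProf' a y := by
      have h1 : -2 * logDerivProf' a y ≤ 0 := by
        rw [logDerivProf'_eq ha hy.1]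
        refine div_nonpos_of_nonpos_of_nonneg ?_ (mul_pos hS hD).le
        have e : Real.cosh y ^ 2 + 2 * a * Real.cosh y - 3
            = (Real.cosh y - Real.cosh b) * (Real.cosh y + (Real.cosh b + 2 * a)) := by
          linear_combination hbe
        rw [e]
        refine mul_nonpos_of_nonpos_of_nonneg (by linarith) ?_
        have h1 : 0 < Real.cosh b + 2 * a := by
          by_contra hcon
          nlinarith
        linarith
      linarith
    have hS2 : Real.sinh y ^ 2 ≤ 8 := by
      rw [Real.sinh_sq]
      nlinarith
    nlinarith [mul_nonneg hV hS.le]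

/-! ### Coercivity on the line -/

/-- Subtracting a multiple of a solution `χ` of `χ'' = P χ` does not change the energy on the
half-line, if the boundary terms vanish. -/
theorem IsSob.energy_Ioi_sub {f f' χ χ' P P' : ℝ → ℝ} (hP : IsBddC1 P P') (hf : IsSob f f')
    (hχ : IsSob χ χ') (hχ' : IsSob χ' (fun x => P x * χ x)) (h1 : f 0 * χ' 0 = 0)
    (h2 : χ 0 * χ' 0 = 0) (c : ℝ) :
    ∫ x in Ioi (0 : ℝ), ((f' x - c * χ' x) ^ 2 + P x * (f x - c * χ x) ^ 2)
      = ∫ x in Ioi (0 : ℝ), (f' x ^ 2 + P x * f x ^ 2) := by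
  obtain ⟨K, hK⟩ := hP.bdd
  have i1 := (hf.integrable_energy hP.continuous hK).integrableOn (s := Ioi 0)
  have i2 : IntegrableOn (fun x => f' x * χ' x + f x * (P x * χ x)) (Ioi 0) volume :=
    ((integrable_mul_L2 hf.memLp' hχ'.memLp).add
      (integrable_mul_L2 hf.memLp hχ'.memLp')).integrableOn
  have i3 : IntegrableOn (fun x => χ' x * χ' x + χ x * (P x * χ x)) (Ioi 0) volume :=
    ((integrable_mul_L2 hχ.memLp' hχ'.memLp).add
      (integrable_mul_L2 hχ.memLp hχ'.memLp')).integrableOn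
  have e1 := hf.integral_Ioi_deriv_mul hχ' 0
  have e2 := hχ.integral_Ioi_deriv_mul hχ' 0
  rw [h1, neg_zero] at e1
  rw [h2, neg_zero] at e2
  have i4 : IntegrableOn (fun x => -(2 * c) * (f' x * χ' x + f x * (P x * χ x))
      + c ^ 2 * (χ' x * χ' x + χ x * (P x * χ x))) (Ioi 0) volume :=
    (i2.const_mul _).add (i3.const_mul _)
  have e3 : ∫ x in Ioi (0 : ℝ), (-(2 * c) * (f' x * χ' x + f x * (P x * χ x))
      + c ^ 2 * (χ' x * χ' x + χ x * (P x * χ x))) = 0 := by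
    rw [integral_add (i2.const_mul _) (i3.const_mul _), integral_const_mul, integral_const_mul,
      e1, e2]
    ring
  have e4 := integral_add i1 i4
  rw [e3, add_zero] at e4
  rw [← e4]
  congr 1
  funext x
  ring

/-- The energy on the line with an even potential, as a sum of two energies on the half-line. -/
theorem IsSob.energy_eq {f f' P P' : ℝ → ℝ} (hP : IsBddC1 P P') (hPe : ∀ x, P (-x) = P x)
    (hf : IsSob f f') :
    ∫ x, (f' x ^ 2 + P x * f x ^ 2) = (∫ x in Ioi (0 : ℝ), (f' x ^ 2 + P x * f x ^ 2))
      + ∫ x in Ioi (0 : ℝ), ((-f' (-x)) ^ 2 + P x * f (-x) ^ 2) := by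
  obtain ⟨K, hK⟩ := hP.bdd
  rw [integral_eq_Ioi_add_Ioi_neg (hf.integrable_energy hP.continuous hK)]
  simp only [hPe, neg_sq]

/-- Subtracting the multiple of the profile that makes a function vanish at the origin leaves the
energy of `L₋` unchanged, and can only increase the norm of a function orthogonal to the profile. -/
theorem IsSob.coercive_minus {v v' : ℝ → ℝ} (ha : |a| < 1) (hv : IsSob v v')
    (ho : ∫ y, v y * prof a y = 0) :
    1 / 256 * ∫ y, v y ^ 2 ≤ ∫ y, (v' y ^ 2 + pMinus a y * v y ^ 2) := by
  have hP := isBddC1_pMinus ha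
  have he := isSob_prof ha
  obtain ⟨K, hK⟩ := hP.bdd
  set c := v 0 / prof a 0 with hc
  have hz0 : v 0 - c * prof a 0 = 0 := by
    rw [hc, div_mul_cancel₀ _ (prof_pos ha 0).ne', sub_self]
  have half : ∀ f f' : ℝ → ℝ, IsSob f f' → f 0 = v 0 →
      1 / 256 * (∫ y in Ioi (0 : ℝ), (f y - c * prof a y) ^ 2)
        ≤ ∫ y in Ioi (0 : ℝ), (f' y ^ 2 + pMinus a y * f y ^ 2) := by
    intro f f' hf hf0
    have hz := hf.sub_const_mul c he
    have h1 := hz.half_line_minus ha (by rw [hf0]; exact hz0)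
    rw [integral_sub (hz.integrable_energy hP.continuous hK).integrableOn
      (hz.integrable_sq.const_mul _).integrableOn, integral_const_mul,
      hf.energy_Ioi_sub hP he (isSob_prof' ha) (by rw [prof'_zero, mul_zero])
        (by rw [prof'_zero, mul_zero])] at h1
    linarith
  have h1 := half v v' hv rfl
  have h2 := half _ _ hv.reflect (by simp)
  have hz := hv.sub_const_mul c he
  have h3 := integral_eq_Ioi_add_Ioi_neg hz.integrable_sq
  simp only [prof_neg] at h3
  rw [hv.energy_eq hP (pMinus_neg a)]
  have h4 : ∫ y, (v y - c * prof a y) ^ 2 = (∫ y, v y ^ 2) + c ^ 2 * ∫ y, prof a y ^ 2 := by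
    have i1 := integrable_mul_L2 hv.memLp he.memLp
    have i2 : Integrable (fun y => -(2 * c) * (v y * prof a y) + c ^ 2 * prof a y ^ 2) volume :=
      (i1.const_mul _).add (he.integrable_sq.const_mul _)
    have e : ∀ y, (v y - c * prof a y) ^ 2
        = v y ^ 2 + (-(2 * c) * (v y * prof a y) + c ^ 2 * prof a y ^ 2) := fun y => by ring
    simp only [e]
    rw [integral_add hv.integrable_sq i2, integral_add (i1.const_mul _)
      (he.integrable_sq.const_mul _), integral_const_mul, integral_const_mul, ho]
    ring
  have h5 : 0 ≤ c ^ 2 * ∫ y, prof a y ^ 2 :=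
    mul_nonneg (sq_nonneg _) (integral_nonneg fun y => sq_nonneg _)
  linarith

/-- On each half-line the energy of `L₊` controls the distance to the span of `prof'`, for functions
vanishing at the origin. -/
theorem IsSob.coercive_plus_of_zero {w w' : ℝ → ℝ} (ha : |a| < 1) (hw : IsSob w w')
    (h0 : w 0 = 0) : ∃ c₁ c₂ : ℝ,
    1 / 576 * ((∫ y in Ioi (0 : ℝ), (w y - c₁ * prof' a y) ^ 2)
      + ∫ y in Ioi (0 : ℝ), (w (-y) - c₂ * prof' a y) ^ 2)
      ≤ ∫ y, (w' y ^ 2 + pPlus a y * w y ^ 2) := by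
  obtain ⟨b, hb, hb3, hbe⟩ := exists_inflection ha
  have hP := isBddC1_pPlus ha
  have he := isSob_prof' ha
  obtain ⟨K, hK⟩ := hP.bdd
  have hbn : prof' a b ≠ 0 := by
    rw [prof']
    exact mul_ne_zero (mul_ne_zero (by norm_num) (profT_pos ha hb).ne') (prof_pos ha b).ne'
  have half : ∀ f f' : ℝ → ℝ, IsSob f f' → f 0 = 0 →
      1 / 576 * (∫ y in Ioi (0 : ℝ), (f y - f b / prof' a b * prof' a y) ^ 2)
        ≤ ∫ y in Ioi (0 : ℝ), (f' y ^ 2 + pPlus a y * f y ^ 2) := by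
    intro f f' hf hf0
    set c := f b / prof' a b with hc
    have hz := hf.sub_const_mul c he
    have hz0 : f 0 - c * prof' a 0 = 0 := by rw [hf0, prof'_zero]; ring
    have hzb : f b - c * prof' a b = 0 := by rw [hc, div_mul_cancel₀ _ hbn, sub_self]
    have hi := (hz.integrable_energy hP.continuous hK).sub (hz.integrable_sq.const_mul (1 / 576))
    have h1 := hz.half_line_plus_inner ha hb hb3 hbe hz0 hzb
    have h2 := hz.half_line_plus_outer ha hb hb3 hbe hzb
    have h3 := intervalIntegral.integral_interval_add_Ioi
      (hi.integrableOn (s := Ioi (0 : ℝ))) (hi.integrableOn (s := Ioi b))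
    have h4 := integral_sub (hz.integrable_energy hP.continuous hK).integrableOn
      (hz.integrable_sq.const_mul (1 / 576)).integrableOn (μ := volume.restrict (Ioi (0 : ℝ)))
    rw [integral_const_mul, hf.energy_Ioi_sub hP he (isSob_prof'' ha) (by rw [hf0, zero_mul])
      (by rw [prof'_zero, zero_mul])] at h4
    simp only [Pi.sub_apply] at h3
    linarith
  refine ⟨w b / prof' a b, w (-b) / prof' a b, ?_⟩
  have h1 := half w w' hw h0
  have h2 := half _ _ hw.reflect (by simpa using h0)
  rw [hw.energy_eq hP (pPlus_neg a)]
  linarith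

end DNLS

namespace DNLS

open Filter Topology Set

/-- The energy after subtracting a multiple of a solution `χ` of `(-∂² + P) χ = h`. -/
theorem IsSob.energy_sub {f f' χ χ' h P P' : ℝ → ℝ} (hP : IsBddC1 P P') (hf : IsSob f f')
    (hχ : IsSob χ χ') (hχ' : IsSob χ' (fun x => P x * χ x - h x)) (hh : MemLp h 2 volume) (c : ℝ) :
    ∫ x, ((f' x - c * χ' x) ^ 2 + P x * (f x - c * χ x) ^ 2)
      = (∫ x, (f' x ^ 2 + P x * f x ^ 2)) - 2 * c * (∫ x, f x * h x) + c ^ 2 * ∫ x, χ x * h x := by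
  obtain ⟨K, hK⟩ := hP.bdd
  have i1 := hf.integrable_energy hP.continuous hK
  have i2 : Integrable (fun x => f' x * χ' x + f x * (P x * χ x - h x)) volume :=
    (integrable_mul_L2 hf.memLp' hχ'.memLp).add (integrable_mul_L2 hf.memLp hχ'.memLp')
  have i3 : Integrable (fun x => χ' x * χ' x + χ x * (P x * χ x - h x)) volume :=
    (integrable_mul_L2 hχ.memLp' hχ'.memLp).add (integrable_mul_L2 hχ.memLp hχ'.memLp')
  have i4 := integrable_mul_L2 hf.memLp hh
  have i5 := integrable_mul_L2 hχ.memLp hh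
  have i6 : Integrable (fun x => -(2 * c) * (f' x * χ' x + f x * (P x * χ x - h x))
      + c ^ 2 * (χ' x * χ' x + χ x * (P x * χ x - h x))) volume :=
    (i2.const_mul _).add (i3.const_mul _)
  have i7 : Integrable (fun x => -(2 * c) * (f x * h x) + c ^ 2 * (χ x * h x)) volume :=
    (i4.const_mul _).add (i5.const_mul _)
  have e6 : ∫ x, (-(2 * c) * (f' x * χ' x + f x * (P x * χ x - h x))
      + c ^ 2 * (χ' x * χ' x + χ x * (P x * χ x - h x))) = 0 := by
    rw [integral_add (i2.const_mul _) (i3.const_mul _), integral_const_mul, integral_const_mul,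
      hf.integral_deriv_mul hχ', hχ.integral_deriv_mul hχ']
    ring
  have e7 : ∫ x, (-(2 * c) * (f x * h x) + c ^ 2 * (χ x * h x))
      = -(2 * c) * (∫ x, f x * h x) + c ^ 2 * ∫ x, χ x * h x := by
    rw [integral_add (i4.const_mul _) (i5.const_mul _), integral_const_mul, integral_const_mul]
  have e : ∀ x, (f' x - c * χ' x) ^ 2 + P x * (f x - c * χ x) ^ 2
      = (f' x ^ 2 + P x * f x ^ 2) + ((-(2 * c) * (f' x * χ' x + f x * (P x * χ x - h x))
      + c ^ 2 * (χ' x * χ' x + χ x * (P x * χ x - h x)))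
      + (-(2 * c) * (f x * h x) + c ^ 2 * (χ x * h x))) := fun x => by ring
  have i8 : Integrable (fun x => (-(2 * c) * (f' x * χ' x + f x * (P x * χ x - h x))
      + c ^ 2 * (χ' x * χ' x + χ x * (P x * χ x - h x)))
      + (-(2 * c) * (f x * h x) + c ^ 2 * (χ x * h x))) volume := i6.add i7
  simp only [e]
  rw [integral_add i1 i8, integral_add i6 i7, e6, e7]
  ring

theorem integral_sq_le_two_mul {μ : Measure ℝ} {f g : ℝ → ℝ} (c : ℝ)
    (hf : Integrable (fun x => (f x - c * g x) ^ 2) μ) (hg : Integrable (fun x => g x ^ 2) μ) :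
    ∫ x, f x ^ 2 ∂μ ≤ 2 * (∫ x, (f x - c * g x) ^ 2 ∂μ) + 2 * c ^ 2 * ∫ x, g x ^ 2 ∂μ := by
  rw [← integral_const_mul, ← integral_const_mul,
    ← integral_add (hf.const_mul _) (hg.const_mul _)]
  refine integral_mono_of_nonneg (Eventually.of_forall fun x => sq_nonneg _)
    ((hf.const_mul _).add (hg.const_mul _)) (Eventually.of_forall fun x => ?_)
  simp only
  nlinarith [sq_nonneg (f x - 2 * c * g x)]

variable {a : ℝ}

theorem integral_Ioi_prof'_sq_pos (ha : |a| < 1) : 0 < ∫ y in Ioi (0 : ℝ), prof' a y ^ 2 := by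
  have hp : ∀ y ∈ Ioi (0 : ℝ), 0 < prof' a y ^ 2 := fun y hy => by
    have h1 := (profT_pos ha hy).ne'
    have h2 := (prof_pos ha y).ne'
    rw [prof']
    positivity
  rw [integral_pos_iff_support_of_nonneg (fun y => sq_nonneg _)
    (isSob_prof' ha).integrable_sq.integrableOn]
  have hsub : Ioi (0 : ℝ) ⊆ Function.support fun y => prof' a y ^ 2 := fun y hy => (hp y hy).ne'
  rw [Measure.restrict_apply' measurableSet_Ioi, inter_eq_self_of_subset_right hsub]
  simp

theorem integral_Ioi_prof_mul_prof' (ha : |a| < 1) :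
    ∫ y in Ioi (0 : ℝ), prof a y * prof' a y = -(1 / 2 * prof a 0 ^ 2) := by
  have h := (isSob_prof ha).integral_Ioi_deriv_mul (isSob_prof ha) 0
  have e : ∀ y, prof' a y * prof a y + prof a y * prof' a y = 2 * (prof a y * prof' a y) :=
    fun y => by ring
  simp only [e] at h
  rw [integral_const_mul] at h
  linarith

/-- If `c₁ - c₂` and `c₁ + c₂` are determined by pairings which are bounded by the Cauchy-Schwarz
inequality, then so are `c₁` and `c₂`. -/
theorem sq_add_sq_le_of_pairings {m n E Z₁ Z₂ A p₁ p₂ p₃ p₄ c₁ c₂ : ℝ} (hm : 0 < m)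
    (hn : 0 < n ^ 2) (hE : 0 ≤ E) (hZ₁ : 0 ≤ Z₁) (hZ₂ : 0 ≤ Z₂) (s1 : p₁ ^ 2 ≤ Z₁ * m)
    (s2 : p₂ ^ 2 ≤ Z₂ * m) (s3 : p₃ ^ 2 ≤ Z₁ * E) (s4 : p₄ ^ 2 ≤ Z₂ * E)
    (t1 : 0 = p₁ + c₁ * m + -(p₂ + c₂ * m)) (t2 : A = p₃ + c₁ * n + (p₄ + c₂ * n)) :
    c₁ ^ 2 + c₂ ^ 2 ≤ (1 / m + 3 / 2 * (1 + E) / n ^ 2) * (Z₁ + Z₂ + A ^ 2) := by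
  have d1 : (c₁ - c₂) ^ 2 ≤ 2 / m * (Z₁ + Z₂) := by
    have h1 : ((c₁ - c₂) * m) ^ 2 ≤ 2 * m * (Z₁ + Z₂) := by
      have : (c₁ - c₂) * m = p₂ - p₁ := by linarith
      rw [this]
      nlinarith only [sq_nonneg (p₂ + p₁), s1, s2]
    rw [div_mul_eq_mul_div, le_div_iff₀ hm]
    refine le_of_mul_le_mul_right ?_ hm
    linarith
  have d2 : (c₁ + c₂) ^ 2 ≤ 3 * (1 + E) / n ^ 2 * (Z₁ + Z₂ + A ^ 2) := by
    have h1 : ((c₁ + c₂) * n) ^ 2 ≤ 3 * (1 + E) * (Z₁ + Z₂ + A ^ 2) := by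
      have h2 : (c₁ + c₂) * n = A - p₃ - p₄ := by linarith
      have h3 : (A - p₃ - p₄) ^ 2 ≤ 3 * (A ^ 2 + p₃ ^ 2 + p₄ ^ 2) := by
        nlinarith only [sq_nonneg (A + p₃), sq_nonneg (A + p₄), sq_nonneg (p₃ - p₄)]
      have h4 : 0 ≤ E * A ^ 2 := by positivity
      rw [h2]
      nlinarith only [h3, h4, s3, s4, hZ₁, hZ₂]
    rw [div_mul_eq_mul_div, le_div_iff₀ hn]
    linarith
  have h1 : 2 / m * (Z₁ + Z₂) ≤ 2 / m * (Z₁ + Z₂ + A ^ 2) :=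
    mul_le_mul_of_nonneg_left (by linarith [sq_nonneg A]) (by positivity)
  have h2 : (1 / m + 3 / 2 * (1 + E) / n ^ 2) * (Z₁ + Z₂ + A ^ 2)
      = 1 / 2 * (2 / m * (Z₁ + Z₂ + A ^ 2))
        + 1 / 2 * (3 * (1 + E) / n ^ 2 * (Z₁ + Z₂ + A ^ 2)) := by
    ring
  have h3 : c₁ ^ 2 + c₂ ^ 2 = 1 / 2 * (c₁ - c₂) ^ 2 + 1 / 2 * (c₁ + c₂) ^ 2 := by ring
  linarith

/-- A function which is close to `c₁ prof'` on the right half-line, and whose reflection is close to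
`c₂ prof'` there, is small if it is almost orthogonal to `prof` and orthogonal to `prof'`: the two
pairings determine `c₁ + c₂` and `c₁ - c₂`. -/
theorem exists_norm_le (ha : |a| < 1) : ∃ K, 0 ≤ K ∧ ∀ (w : ℝ → ℝ) (c₁ c₂ : ℝ),
    MemLp w 2 volume → ∫ y, w y * prof' a y = 0 →
    ∫ y, w y ^ 2 ≤ K * ((∫ y in Ioi (0 : ℝ), (w y - c₁ * prof' a y) ^ 2)
      + (∫ y in Ioi (0 : ℝ), (w (-y) - c₂ * prof' a y) ^ 2) + (∫ y, w y * prof a y) ^ 2) := by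
  have hm := integral_Ioi_prof'_sq_pos ha
  set m := ∫ y in Ioi (0 : ℝ), prof' a y ^ 2 with hmdef
  set E := ∫ y in Ioi (0 : ℝ), prof a y ^ 2 with hE
  have hE0 : 0 ≤ E := integral_nonneg fun y => sq_nonneg _
  have hnn := integral_Ioi_prof_mul_prof' ha
  set n := ∫ y in Ioi (0 : ℝ), prof a y * prof' a y with hndef
  have hn : 0 < n ^ 2 := by
    have := prof_pos ha 0
    rw [hnn, neg_sq]
    positivity
  set κ := 1 / m + 3 / 2 * (1 + E) / n ^ 2 with hκ
  have hκ0 : 0 ≤ κ := by positivity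
  refine ⟨2 + 2 * m * κ, by positivity, fun w c₁ c₂ hw ho => ?_⟩
  have he := memLp_prof ha
  have he' := (isSob_prof' ha).memLp
  have mz1 : MemLp (fun y => w y - c₁ * prof' a y) 2 (volume.restrict (Ioi (0 : ℝ))) :=
    (hw.sub (he'.const_mul c₁)).restrict _
  have mz2 : MemLp (fun y => w (-y) - c₂ * prof' a y) 2 (volume.restrict (Ioi (0 : ℝ))) :=
    ((memLp_comp_neg hw).sub (he'.const_mul c₂)).restrict _
  have me := he.restrict (Ioi (0 : ℝ))
  have me' := he'.restrict (Ioi (0 : ℝ))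
  have sqi : ∀ {f : ℝ → ℝ}, MemLp f 2 (volume.restrict (Ioi (0 : ℝ))) →
      Integrable (fun y => f y ^ 2) (volume.restrict (Ioi (0 : ℝ))) := fun hf =>
    (memLp_two_iff_integrable_sq hf.1).1 hf
  set Z₁ := ∫ y in Ioi (0 : ℝ), (w y - c₁ * prof' a y) ^ 2 with hZ1
  set Z₂ := ∫ y in Ioi (0 : ℝ), (w (-y) - c₂ * prof' a y) ^ 2 with hZ2
  set A := ∫ y, w y * prof a y with hA
  -- The four pairings of the remainders.
  have s1 := cauchy_schwarz mz1 me'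
  have s2 := cauchy_schwarz mz2 me'
  have s3 := cauchy_schwarz mz1 me
  have s4 := cauchy_schwarz mz2 me
  rw [← hZ1, ← hmdef] at s1
  rw [← hZ2, ← hmdef] at s2
  rw [← hZ1, ← hE] at s3
  rw [← hZ2, ← hE] at s4
  have expand : ∀ (f g : ℝ → ℝ) (c : ℝ), MemLp (fun y => f y - c * prof' a y) 2
      (volume.restrict (Ioi (0 : ℝ))) → MemLp g 2 (volume.restrict (Ioi (0 : ℝ))) →
      ∫ y in Ioi (0 : ℝ), f y * g y = (∫ y in Ioi (0 : ℝ), (f y - c * prof' a y) * g y)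
        + c * ∫ y in Ioi (0 : ℝ), g y * prof' a y := by
    intro f g c hf hg
    have i1 : Integrable (fun y => (f y - c * prof' a y) * g y) (volume.restrict (Ioi (0 : ℝ))) :=
      hf.integrable_mul hg
    have i2 : Integrable (fun y => g y * prof' a y) (volume.restrict (Ioi (0 : ℝ))) :=
      hg.integrable_mul me'
    rw [← integral_const_mul, ← integral_add i1 (i2.const_mul c)]
    congr 1
    funext y
    ring
  have hm2 : ∫ y in Ioi (0 : ℝ), prof' a y * prof' a y = m := by
    rw [hmdef]
    congr 1
    funext y
    ring
  have x1 := expand w (prof' a) c₁ mz1 me'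
  have x2 := expand (fun y => w (-y)) (prof' a) c₂ mz2 me'
  have x3 := expand w (prof a) c₁ mz1 me
  have x4 := expand (fun y => w (-y)) (prof a) c₂ mz2 me
  have t1 := integral_eq_Ioi_add_Ioi_neg (integrable_mul_L2 hw he')
  have t2 := integral_eq_Ioi_add_Ioi_neg (integrable_mul_L2 hw he)
  simp only [prof'_neg, mul_neg, MeasureTheory.integral_neg] at t1
  simp only [prof_neg] at t2
  rw [ho, x1, x2, hm2] at t1
  rw [← hA, x3, x4, ← hndef] at t2
  set p₁ := ∫ y in Ioi (0 : ℝ), (w y - c₁ * prof' a y) * prof' a y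
  set p₂ := ∫ y in Ioi (0 : ℝ), (w (-y) - c₂ * prof' a y) * prof' a y
  set p₃ := ∫ y in Ioi (0 : ℝ), (w y - c₁ * prof' a y) * prof a y
  set p₄ := ∫ y in Ioi (0 : ℝ), (w (-y) - c₂ * prof' a y) * prof a y
  have hZ10 : 0 ≤ Z₁ := integral_nonneg fun y => sq_nonneg _
  have hZ20 : 0 ≤ Z₂ := integral_nonneg fun y => sq_nonneg _
  have d3 : c₁ ^ 2 + c₂ ^ 2 ≤ κ * (Z₁ + Z₂ + A ^ 2) :=
    sq_add_sq_le_of_pairings hm hn hE0 hZ10 hZ20 s1 s2 s3 s4 t1 t2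
  have t3 := integral_eq_Ioi_add_Ioi_neg (integrable_sq_L2 hw)
  have b1 := integral_sq_le_two_mul c₁ (sqi mz1) (sqi me')
  have b2 := integral_sq_le_two_mul (f := fun y => w (-y)) c₂ (sqi mz2) (sqi me')
  rw [← hZ1, ← hmdef] at b1
  rw [← hZ2, ← hmdef] at b2
  have d4 := mul_le_mul_of_nonneg_left d3 hm.le
  have e : (2 + 2 * m * κ) * (Z₁ + Z₂ + A ^ 2)
      = 2 * (Z₁ + Z₂ + A ^ 2) + 2 * (m * (κ * (Z₁ + Z₂ + A ^ 2))) := by ring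
  rw [t3, e]
  linarith [sq_nonneg A]

/-- The elementary inequality that bounds the norms by those of the remainders. -/
theorem norm_le_of_remainders {K NΨ NZ Z₁ Z₂ Z W U V α p : ℝ} (hK : 0 ≤ K) (hNΨ : 0 ≤ NΨ)
    (hNZ : 0 ≤ NZ) (hZ₁ : 0 ≤ Z₁) (hZ₂ : 0 ≤ Z₂) (hZ : 0 ≤ Z)
    (hW : W ≤ K * (Z₁ + Z₂ + (-(α * p)) ^ 2)) (hU : U ≤ 2 * W + 2 * α ^ 2 * NΨ)
    (hV : V ≤ 2 * Z + 2 * α ^ 2 * NZ) :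
    U + V ≤ (2 * NΨ + 2 * K * (1 + p ^ 2) + 2 + 2 * NZ) * (Z₁ + Z₂ + Z + α ^ 2) := by
  have m1 : K * (Z₁ + Z₂ + (-(α * p)) ^ 2) ≤ K * ((1 + p ^ 2) * (Z₁ + Z₂ + Z + α ^ 2)) := by
    refine mul_le_mul_of_nonneg_left ?_ hK
    have h : 0 ≤ p ^ 2 * (Z₁ + Z₂ + Z) := by positivity
    linarith [sq_nonneg α]
  have m2 : NΨ * α ^ 2 ≤ NΨ * (Z₁ + Z₂ + Z + α ^ 2) :=
    mul_le_mul_of_nonneg_left (by linarith) hNΨ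
  have m3 : NZ * α ^ 2 ≤ NZ * (Z₁ + Z₂ + Z + α ^ 2) :=
    mul_le_mul_of_nonneg_left (by linarith) hNZ
  linarith [sq_nonneg α]

/-- Coercivity in `L²`. The multiple `α Ψ` of the dual vector that makes the real part vanish at the
origin is subtracted; as `Ψ` is dual to the constraint vector and the form is negative at `Ψ`, this
lowers the energy by a multiple of `α²`. -/
theorem coercive_L2 (ha : |a| < 1) : ∃ δ, 0 < δ ∧ ∀ u u' v v' : ℝ → ℝ, IsSob u u' → IsSob v v' →
    ∫ y, v y * prof a y = 0 → ∫ y, u y * prof a y = 0 → ∫ y, u y * prof' a y = 0 →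
    √(1 - a ^ 2) * (∫ y, u y * (profR a y * prof a y)) + ∫ y, v y * prof' a y = 0 →
    δ * ((∫ y, u y ^ 2) + ∫ y, v y ^ 2) ≤ (∫ y, (u' y ^ 2 + pPlus a y * u y ^ 2))
      + ∫ y, (v' y ^ 2 + pMinus a y * v y ^ 2) := by
  obtain ⟨K, hK0, hK⟩ := exists_norm_le ha
  set σ := √(1 - a ^ 2) with hσ
  have hσ0 : 0 < σ := sqrt_one_sub_sq_pos ha
  have hΨ := isSob_dualRe ha
  have hZ := isSob_dualIm ha
  set p := ∫ y, dualRe a y * prof a y with hp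
  set NΨ := ∫ y, dualRe a y ^ 2 with hNΨ
  set NZ := ∫ y, dualIm a y ^ 2 with hNZ
  have hNΨ0 : 0 ≤ NΨ := integral_nonneg fun y => sq_nonneg _
  have hNZ0 : 0 ≤ NZ := integral_nonneg fun y => sq_nonneg _
  set M := 2 * NΨ + 2 * K * (1 + p ^ 2) + 2 + 2 * NZ with hM
  have hM0 : 0 < M := by positivity
  set δ₀ := min (1 / 576) σ with hδ₀
  have hδ₀0 : 0 < δ₀ := lt_min (by norm_num) hσ0
  refine ⟨δ₀ / M, by positivity, fun u u' v v' hu hv hvo huo huo' huv => ?_⟩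
  obtain ⟨L, hL⟩ := bdd_profR ha
  have mRe : MemLp (fun y => profR a y * prof a y) 2 volume :=
    memLp_bdd_mul (memLp_prof ha) (continuous_profR ha) hL
  have mh : MemLp (fun y => 1 / 2 * prof a y + σ * (profR a y * prof a y)) 2 volume :=
    ((memLp_prof ha).const_mul _).add (mRe.const_mul _)
  set α := u 0 / dualRe a 0 with hα
  have hw := hu.sub_const_mul α hΨ
  have hz := hv.sub_const_mul α hZ
  have hw0 : u 0 - α * dualRe a 0 = 0 := by
    rw [hα, div_mul_cancel₀ _ (dualRe_zero_ne ha), sub_self]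
  -- Orthogonality of the dual vector to the even and odd constraints, by parity.
  have o1 : ∫ y, dualRe a y * prof' a y = 0 :=
    integral_eq_zero_of_odd fun y => by rw [dualRe_neg, prof'_neg]; ring
  have o2 : ∫ y, dualIm a y * prof a y = 0 :=
    integral_eq_zero_of_odd fun y => by rw [dualIm_neg, prof_neg]; ring
  have pairing_sub : ∀ f g h : ℝ → ℝ, MemLp f 2 volume → MemLp g 2 volume → MemLp h 2 volume →
      ∫ y, (f y - α * g y) * h y = (∫ y, f y * h y) - α * ∫ y, g y * h y := by
    intro f g h hf hg hh
    rw [← integral_const_mul, ← integral_sub (integrable_mul_L2 hf hh)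
      ((integrable_mul_L2 hg hh).const_mul _)]
    congr 1
    funext y
    ring
  have w1 : ∫ y, (u y - α * dualRe a y) * prof' a y = 0 := by
    rw [pairing_sub _ _ _ hu.memLp hΨ.memLp (isSob_prof' ha).memLp, huo', o1]
    ring
  have w2 : ∫ y, (u y - α * dualRe a y) * prof a y = -(α * p) := by
    rw [pairing_sub _ _ _ hu.memLp hΨ.memLp (memLp_prof ha), huo]
    ring
  have z1 : ∫ y, (v y - α * dualIm a y) * prof a y = 0 := by
    rw [pairing_sub _ _ _ hv.memLp hZ.memLp (memLp_prof ha), hvo, o2]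
    ring
  obtain ⟨c₁, c₂, hc⟩ := hw.coercive_plus_of_zero ha hw0
  have hk := hK _ c₁ c₂ hw.memLp w1
  have hcz := hz.coercive_minus ha z1
  rw [w2] at hk
  have e1 := hu.energy_sub (isBddC1_pPlus ha) hΨ (isSob_dualRe' ha) mh α
  have e2 := hv.energy_sub (isBddC1_pMinus ha) hZ (isSob_dualIm' ha) (isSob_prof' ha).memLp α
  have e3 : ∫ y, u y * (1 / 2 * prof a y + σ * (profR a y * prof a y))
      = σ * ∫ y, u y * (profR a y * prof a y) := by
    have i1 := integrable_mul_L2 hu.memLp (memLp_prof ha)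
    have i2 := integrable_mul_L2 hu.memLp mRe
    have e : ∀ y, u y * (1 / 2 * prof a y + σ * (profR a y * prof a y))
        = 1 / 2 * (u y * prof a y) + σ * (u y * (profR a y * prof a y)) := fun y => by ring
    simp only [e]
    rw [integral_add (i1.const_mul _) (i2.const_mul _), integral_const_mul, integral_const_mul, huo]
    ring
  have e4 := integral_dual ha
  rw [← hσ] at e4
  rw [e3] at e1
  have b1 := integral_sq_le_two_mul α hw.integrable_sq hΨ.integrable_sq
  have b2 := integral_sq_le_two_mul α hz.integrable_sq hZ.integrable_sq
  rw [← hNΨ] at b1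
  rw [← hNZ] at b2
  set Z₁ := ∫ y in Ioi (0 : ℝ), (u y - α * dualRe a y - c₁ * prof' a y) ^ 2
  set Z₂ := ∫ y in Ioi (0 : ℝ), (u (-y) - α * dualRe a (-y) - c₂ * prof' a y) ^ 2
  set Z := ∫ y, (v y - α * dualIm a y) ^ 2
  set W := ∫ y, (u y - α * dualRe a y) ^ 2
  set X := ∫ y, u y * (profR a y * prof a y)
  set Y := ∫ y, v y * prof' a y
  set G₁ := ∫ y, dualRe a y * (1 / 2 * prof a y + σ * (profR a y * prof a y))
  set G₂ := ∫ y, dualIm a y * prof' a y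
  have hZ10 : 0 ≤ Z₁ := integral_nonneg fun y => sq_nonneg _
  have hZ20 : 0 ≤ Z₂ := integral_nonneg fun y => sq_nonneg _
  have hZ0 : 0 ≤ Z := integral_nonneg fun y => sq_nonneg _
  have hα0 : 0 ≤ α ^ 2 := sq_nonneg _
  have q1 : δ₀ * (Z₁ + Z₂ + Z + α ^ 2) ≤ (∫ y, (u' y ^ 2 + pPlus a y * u y ^ 2))
      + ∫ y, (v' y ^ 2 + pMinus a y * v y ^ 2) := by
    have m1 : δ₀ * (Z₁ + Z₂) ≤ 1 / 576 * (Z₁ + Z₂) :=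
      mul_le_mul_of_nonneg_right (min_le_left _ _) (by positivity)
    have m2 : δ₀ * Z ≤ 1 / 256 * Z :=
      mul_le_mul_of_nonneg_right ((min_le_left _ _).trans (by norm_num)) hZ0
    have m3 : δ₀ * α ^ 2 ≤ σ * α ^ 2 := mul_le_mul_of_nonneg_right (min_le_right _ _) hα0
    have m4 : 2 * α * (σ * X) + 2 * α * Y = 0 := by
      linear_combination (2 * α) * huv
    have m5 : α ^ 2 * G₁ + α ^ 2 * G₂ = -(σ * α ^ 2) := by
      linear_combination (α ^ 2) * e4
    linarith
  have q2 : (∫ y, u y ^ 2) + (∫ y, v y ^ 2) ≤ M * (Z₁ + Z₂ + Z + α ^ 2) :=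
    norm_le_of_remainders hK0 hNΨ0 hNZ0 hZ10 hZ20 hZ0 hk b1 b2
  calc δ₀ / M * ((∫ y, u y ^ 2) + ∫ y, v y ^ 2) ≤ δ₀ / M * (M * (Z₁ + Z₂ + Z + α ^ 2)) :=
        mul_le_mul_of_nonneg_left q2 (by positivity)
    _ = δ₀ * (Z₁ + Z₂ + Z + α ^ 2) := by
        field_simp
    _ ≤ _ := q1

theorem IsSob.energy_ge {f f' P P' : ℝ → ℝ} (hP : IsBddC1 P P') {K : ℝ} (hK : ∀ x, |P x| ≤ K)
    (hf : IsSob f f') :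
    (∫ x, f' x ^ 2) - K * (∫ x, f x ^ 2) ≤ ∫ x, (f' x ^ 2 + P x * f x ^ 2) := by
  rw [← integral_const_mul, ← integral_sub hf.integrable_sq' (hf.integrable_sq.const_mul K)]
  refine integral_mono (hf.integrable_sq'.sub (hf.integrable_sq.const_mul K))
    (hf.integrable_energy hP.continuous hK) fun x => ?_
  have h := (abs_le.1 (hK x)).1
  simp only
  nlinarith [mul_nonneg (sub_nonneg.2 h) (sq_nonneg (f x))]

/-- Coercivity in `H¹`, by interpolation with the trivial lower bound for the energy. -/
theorem coercive_H1 (ha : |a| < 1) : ∃ δ, 0 < δ ∧ ∀ u u' v v' : ℝ → ℝ, IsSob u u' → IsSob v v' →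
    ∫ y, v y * prof a y = 0 → ∫ y, u y * prof a y = 0 → ∫ y, u y * prof' a y = 0 →
    √(1 - a ^ 2) * (∫ y, u y * (profR a y * prof a y)) + ∫ y, v y * prof' a y = 0 →
    δ * (((∫ y, u y ^ 2) + ∫ y, u' y ^ 2) + ((∫ y, v y ^ 2) + ∫ y, v' y ^ 2))
      ≤ (∫ y, (u' y ^ 2 + pPlus a y * u y ^ 2)) + ∫ y, (v' y ^ 2 + pMinus a y * v y ^ 2) := by
  obtain ⟨δ, hδ, H⟩ := coercive_L2 ha
  obtain ⟨K₁, hK₁⟩ := (isBddC1_pPlus ha).bdd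
  obtain ⟨K₂, hK₂⟩ := (isBddC1_pMinus ha).bdd
  have hK1 := (abs_nonneg _).trans (hK₁ 0)
  have hK2 := (abs_nonneg _).trans (hK₂ 0)
  set t := δ / (δ + (K₁ + K₂) + 1) with ht
  have htd : 0 < δ + (K₁ + K₂) + 1 := by positivity
  have ht0 : 0 < t := div_pos hδ htd
  have ht1 : t ≤ 1 := by
    rw [ht, div_le_one htd]
    linarith
  have hte : t * (δ + (K₁ + K₂) + 1) = δ := div_mul_cancel₀ _ htd.ne'
  refine ⟨t, ht0, fun u u' v v' hu hv h1 h2 h3 h4 => ?_⟩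
  have g1 := H u u' v v' hu hv h1 h2 h3 h4
  have g2 := hu.energy_ge (isBddC1_pPlus ha) hK₁
  have g3 := hv.energy_ge (isBddC1_pMinus ha) hK₂
  set Q₁ := ∫ y, (u' y ^ 2 + pPlus a y * u y ^ 2)
  set Q₂ := ∫ y, (v' y ^ 2 + pMinus a y * v y ^ 2)
  have n1 : 0 ≤ ∫ y, u y ^ 2 := integral_nonneg fun y => sq_nonneg _
  have n2 : 0 ≤ ∫ y, v y ^ 2 := integral_nonneg fun y => sq_nonneg _
  set U := ∫ y, u y ^ 2
  set V := ∫ y, v y ^ 2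
  set U' := ∫ y, u' y ^ 2
  set V' := ∫ y, v' y ^ 2
  have k1 : U' + V' - (K₁ + K₂) * (U + V) ≤ Q₁ + Q₂ := by
    nlinarith [mul_nonneg hK1 n2, mul_nonneg hK2 n1]
  have k2 := mul_le_mul_of_nonneg_left g1 (sub_nonneg.2 ht1)
  have k3 := mul_le_mul_of_nonneg_left k1 ht0.le
  have k4 : (1 - t) * (δ * (U + V)) + t * (U' + V' - (K₁ + K₂) * (U + V))
      = t * ((U + U') + (V + V')) := by
    linear_combination (-(U + V)) * hte
  linarith

end DNLS

/-! ### Rescaling -/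

namespace DNLS

open Filter Topology Set

theorem memLp_comp_mul {f : ℝ → ℝ} (hf : MemLp f 2 volume) {r : ℝ} (hr : r ≠ 0) :
    MemLp (fun x => f (r * x)) 2 volume := by
  have hq : Measure.QuasiMeasurePreserving (fun x : ℝ => r * x) volume volume := by
    refine ⟨measurable_const_mul r, ?_⟩
    rw [Real.map_volume_mul_left hr]
    exact Measure.smul_absolutelyContinuous
  exact (memLp_two_iff_integrable_sq (hf.1.comp_quasiMeasurePreserving hq)).2
    ((integrable_sq_L2 hf).comp_mul_left' hr)

theorem IsSob.comp_mul {f f' : ℝ → ℝ} (hf : IsSob f f') {r : ℝ} (hr : r ≠ 0) :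
    IsSob (fun x => f (r * x)) (fun x => r * f' (r * x)) := by
  refine ⟨memLp_comp_mul hf.memLp hr, (memLp_comp_mul hf.memLp' hr).const_mul r, fun a b => ?_⟩
  rw [intervalIntegral.integral_const_mul, intervalIntegral.integral_comp_mul_left _ hr,
    hf.integral_eq, smul_eq_mul, mul_inv_cancel_left₀ hr]

theorem integral_scale (F : ℝ → ℝ) {r : ℝ} (hr : 0 < r) :
    ∫ x, F (r * x) = r⁻¹ * ∫ y, F y := by
  rw [Measure.integral_comp_mul_left, abs_of_pos (inv_pos.2 hr), smul_eq_mul]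

/-- The continuous representative of an element of `H¹(ℝ)` in the variable `y = r x`. -/
theorem H1.exists_rescaled (η : H1 ℝ) {r : ℝ} (hr : 0 < r) : ∃ u u' : ℝ → ℝ, IsSob u u' ∧
    (∀ g : ℝ → ℝ, pair η.toFun (fun x => g (r * x)) = r⁻¹ * ∫ y, u y * g y) ∧
    normSqL2 η.toFun = r⁻¹ * ∫ y, u y ^ 2 ∧ normSqL2 η.wderiv = r * ∫ y, u' y ^ 2 ∧
    ∀ V P : ℝ → ℝ, (∀ x, V x = r ^ 2 / 2 * P (r * x)) →
      schrodingerForm V η η = r / 2 * ∫ y, (u' y ^ 2 + P y * u y ^ 2) := by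
  obtain ⟨f, hfe, hf⟩ := η.exists_isSob
  have hu := hf.comp_mul (inv_ne_zero hr.ne')
  set u : ℝ → ℝ := fun y => f (r⁻¹ * y) with hudef
  set u' : ℝ → ℝ := fun y => r⁻¹ * η.wderiv (r⁻¹ * y) with hu'def
  have e1 : ∀ᵐ x, η.toFun x = u (r * x) := by
    filter_upwards [hfe] with x hx
    rw [← hx, hudef]
    simp only [inv_mul_cancel_left₀ hr.ne']
  have e2 : ∀ x, η.wderiv x = r * u' (r * x) := by
    intro x
    rw [hu'def]
    simp only [inv_mul_cancel_left₀ hr.ne', mul_inv_cancel_left₀ hr.ne']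
  refine ⟨u, u', hu, fun g => ?_, ?_, ?_, fun V P hVP => ?_⟩
  · rw [pair, ← integral_scale _ hr]
    refine integral_congr_ae ?_
    filter_upwards [e1] with x hx
    rw [hx]
  · rw [normSqL2, ← integral_scale (fun y => u y ^ 2) hr]
    refine integral_congr_ae ?_
    filter_upwards [e1] with x hx
    rw [hx, Real.norm_eq_abs, sq_abs]
  · have e : ∀ x, ‖η.wderiv x‖ ^ 2 = r ^ 2 * (u' (r * x)) ^ 2 := fun x => by
      rw [e2, Real.norm_eq_abs, sq_abs, mul_pow]
    rw [normSqL2]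
    simp only [e]
    rw [integral_const_mul, integral_scale (fun y => u' y ^ 2) hr]
    field_simp
  · have e : schrodingerForm V η η
        = ∫ x, r ^ 2 / 2 * (u' (r * x) ^ 2 + P (r * x) * u (r * x) ^ 2) := by
      refine integral_congr_ae ?_
      filter_upwards [e1] with x hx
      rw [hx, e2, hVP]
      ring
    rw [e, integral_const_mul, integral_scale (fun y => u' y ^ 2 + P y * u y ^ 2) hr]
    field_simp

theorem normSqL2_complex {f : ℝ → ℂ} (hf : MemLp f 2 volume) :
    normSqL2 f = normSqL2 (fun x => (f x).re) + normSqL2 (fun x => (f x).im) := by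
  have h1 : MemLp (fun x => (f x).re) 2 volume := Complex.reCLM.comp_memLp' hf
  have h2 : MemLp (fun x => (f x).im) 2 volume := Complex.imCLM.comp_memLp' hf
  rw [normSqL2, normSqL2, normSqL2]
  simp only [Real.norm_eq_abs, sq_abs]
  rw [← integral_add (integrable_sq_L2 h1) (integrable_sq_L2 h2)]
  congr 1
  funext x
  rw [Complex.sq_norm, Complex.normSq_apply]
  ring

/-- The scaling parameters: `c = 2 r a`, `ω = r²`, and the rate `k` is `2 r √(1 - a²)`. -/
theorem exists_scaling {ω c : ℝ} (h : c ^ 2 < 4 * ω) : ∃ r a k : ℝ, 0 < r ∧ |a| < 1 ∧ 0 < k ∧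
    r = √ω ∧ a = c / (2 * √ω) ∧ k = √(4 * ω - c ^ 2) ∧ ω = r ^ 2 ∧ c = 2 * r * a ∧
    k = 2 * r * √(1 - a ^ 2) := by
  have hω : 0 < ω := by nlinarith [sq_nonneg c]
  have hr : 0 < √ω := Real.sqrt_pos.2 hω
  have hr2 : √ω ^ 2 = ω := Real.sq_sqrt hω.le
  have hc : c = 2 * √ω * (c / (2 * √ω)) := by
    field_simp
  refine ⟨√ω, c / (2 * √ω), √(4 * ω - c ^ 2), hr, ?_, Real.sqrt_pos.2 (by linarith), rfl, rfl,
    rfl, hr2.symm, hc, ?_⟩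
  · rw [← sq_lt_one_iff_abs_lt_one, div_pow, mul_pow, hr2, div_lt_one (by positivity)]
    linarith
  · have e : 4 * ω - c ^ 2 = (2 * √ω) ^ 2 * (1 - (c / (2 * √ω)) ^ 2) := by
      have hc2 : c ^ 2 = (2 * √ω * (c / (2 * √ω))) ^ 2 := by rw [← hc]
      linear_combination -hc2 - 4 * hr2
    rw [e, Real.sqrt_mul (by positivity), Real.sqrt_sq (by positivity)]

/-- The solitary wave is a rescaled normalised profile. -/
theorem phi_eq {ω c r a k : ℝ} (h : c ^ 2 < 4 * ω) (hr : r = √ω) (ha : a = c / (2 * √ω))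
    (hk : k = √(4 * ω - c ^ 2)) (hr0 : 0 < r) (x : ℝ) :
    phi ω c x = √(k ^ 2 / r) * prof a (k * x) := by
  have hk2 : k ^ 2 = 4 * ω - c ^ 2 := by rw [hk, Real.sq_sqrt (by linarith)]
  have hb := (phi_base_pos h x).le
  rw [phi, Real.rpow_neg hb, ← Real.sqrt_eq_rpow, ← Real.sqrt_inv, prof, profR,
    ← Real.sqrt_mul (div_nonneg (sq_nonneg k) hr0.le), ha, hk2, ← hk, hr]
  rw [mul_inv, inv_div]

theorem pot_eq {ω c r a k : ℝ} (hr0 : 0 < r) (ha1 : |a| < 1)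
    (hω : ω = r ^ 2) (hc : c = 2 * r * a) (hkr : k = 2 * r * √(1 - a ^ 2))
    (hphi : ∀ x, phi ω c x = √(k ^ 2 / r) * prof a (k * x)) (x : ℝ) :
    potPlus ω c x = k ^ 2 / 2 * pPlus a (k * x) ∧
      potMinus ω c x = k ^ 2 / 2 * pMinus a (k * x) := by
  have hk2 : k ^ 2 = 4 * r ^ 2 * (1 - a ^ 2) := by
    rw [hkr, mul_pow, sq_sqrt_one_sub_sq ha1]
    ring
  have hp2 : phi ω c x ^ 2 = 4 * r * (1 - a ^ 2) * profR a (k * x) := by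
    rw [hphi, mul_pow, prof_sq ha1, Real.sq_sqrt (div_nonneg (sq_nonneg k) hr0.le), hk2]
    field_simp
  have hp4 : phi ω c x ^ 4 = (4 * r * (1 - a ^ 2) * profR a (k * x)) ^ 2 := by
    rw [← hp2]
    ring
  rw [potPlus, potMinus, hp2, hp4, hk2, pPlus, pMinus, hω, hc]
  constructor <;> ring

end DNLS

open DNLS in
theorem proposition2p1 (ω c : ℝ) (hωc : c ^ 2 < 4 * ω) :
    (∃ C : ℝ, 0 < C ∧ ∀ ψ : DNLS.H1 ℝ,
      DNLS.pair ψ.toFun (DNLS.phi ω c) = 0 →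
      C * DNLS.normSqL2 ψ.toFun ≤ DNLS.LminusPair ω c ψ ψ) ∧
    (∃ C : ℝ, 0 < C ∧ ∀ ψ : DNLS.H1 ℝ,
      DNLS.pair ψ.toFun (DNLS.phi ω c) = 0 →
      DNLS.pair ψ.toFun (fun x => DNLS.phi ω c x ^ 3) = 0 →
      DNLS.pair ψ.toFun (deriv (DNLS.phi ω c)) = 0 →
      C * DNLS.normSqL2 ψ.toFun ≤ DNLS.LplusPair ω c ψ ψ) ∧
    (∃ C : ℝ, 0 < C ∧ ∀ η : DNLS.H1 ℂ,
      DNLS.pair η.im.toFun (DNLS.phi ω c) = 0 →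
      DNLS.pair η.re.toFun (DNLS.phi ω c) = 0 →
      DNLS.pair η.re.toFun (deriv (DNLS.phi ω c)) = 0 →
      1 / 2 * DNLS.pair η.re.toFun (fun x => DNLS.phi ω c x ^ 3)
        + DNLS.pair η.im.toFun (deriv (DNLS.phi ω c)) = 0 →
      C * DNLS.normSqH1 η ≤ DNLS.linEnergy ω c η) := by
  obtain ⟨r, a, k, hr0, ha, hk0, hr, haω, hk, hω, hc, hkr⟩ := exists_scaling hωc
  have hphi := phi_eq hωc hr haω hk hr0
  have hpot := pot_eq hr0 ha hω hc hkr hphi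
  set l := √(k ^ 2 / r) with hl
  have hl0 : 0 < l := Real.sqrt_pos.2 (by positivity)
  have hl2 : l ^ 2 = k ^ 2 / r := Real.sq_sqrt (by positivity)
  have f1 : phi ω c = fun x => (fun y => l * prof a y) (k * x) := funext hphi
  have f2 : deriv (phi ω c) = fun x => (fun y => l * k * prof' a y) (k * x) := by
    funext x
    have h1 := ((hasDerivAt_prof ha (k * x)).comp x ((hasDerivAt_id x).const_mul k)).const_mul l
    rw [f1]
    refine h1.deriv.trans ?_
    simp only [mul_one]
    ring
  have f3 : (fun x => phi ω c x ^ 3)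
      = fun x => (fun y => l ^ 3 * (profR a y * prof a y)) (k * x) := by
    funext x
    simp only [hphi, ← prof_sq ha]
    ring
  -- The constraints in the rescaled variable.
  have c1 : ∀ (f u : ℝ → ℝ), (∀ g : ℝ → ℝ, pair f (fun x => g (k * x)) = k⁻¹ * ∫ y, u y * g y) →
      pair f (phi ω c) = k⁻¹ * l * ∫ y, u y * prof a y := by
    intro f u h
    rw [f1]
    refine (h fun y => l * prof a y).trans ?_
    simp only [mul_left_comm _ l]
    rw [integral_const_mul]
    ring
  have c2 : ∀ (f u : ℝ → ℝ), (∀ g : ℝ → ℝ, pair f (fun x => g (k * x)) = k⁻¹ * ∫ y, u y * g y) →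
      pair f (deriv (phi ω c)) = l * ∫ y, u y * prof' a y := by
    intro f u h
    rw [f2]
    refine (h fun y => l * k * prof' a y).trans ?_
    simp only [mul_left_comm _ (l * k)]
    rw [integral_const_mul]
    field_simp
  have c3 : ∀ (f u : ℝ → ℝ), (∀ g : ℝ → ℝ, pair f (fun x => g (k * x)) = k⁻¹ * ∫ y, u y * g y) →
      1 / 2 * pair f (fun x => phi ω c x ^ 3)
        = l * (√(1 - a ^ 2) * ∫ y, u y * (profR a y * prof a y)) := by
    intro f u h
    rw [f3, h fun y => l ^ 3 * (profR a y * prof a y)]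
    simp only [mul_left_comm _ (l ^ 3)]
    rw [integral_const_mul, pow_succ, hl2]
    have e : √(1 - a ^ 2) = k / (2 * r) := by
      rw [hkr]
      field_simp
    rw [e]
    field_simp
  have hkl : k⁻¹ * l ≠ 0 := by positivity
  obtain ⟨δ, hδ, H⟩ := coercive_H1 ha
  refine ⟨⟨k ^ 2 / 2 * (1 / 256), by positivity, fun ψ h1 => ?_⟩,
    ⟨k ^ 2 / 2 * δ, by positivity, fun ψ h1 h2 h3 => ?_⟩,
    ⟨k / 2 * (δ / (k⁻¹ + k)), by positivity, fun η h1 h2 h3 h4 => ?_⟩⟩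
  · obtain ⟨u, u', hu, hp, hn, -, hV⟩ := ψ.exists_rescaled hk0
    rw [c1 _ _ hp] at h1
    have h := hu.coercive_minus ha ((mul_eq_zero.1 h1).resolve_left hkl)
    rw [LminusPair, hV _ _ fun x => (hpot x).2, hn]
    calc k ^ 2 / 2 * (1 / 256) * (k⁻¹ * ∫ y, u y ^ 2) = k / 2 * (1 / 256 * ∫ y, u y ^ 2) := by
          field_simp
      _ ≤ _ := mul_le_mul_of_nonneg_left h (by positivity)
  · obtain ⟨u, u', hu, hp, hn, -, hV⟩ := ψ.exists_rescaled hk0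
    have h4 := c3 _ _ hp
    rw [c1 _ _ hp] at h1
    rw [c2 _ _ hp] at h3
    rw [h2, mul_zero] at h4
    have hz : IsSob (fun _ => (0 : ℝ)) (fun _ => 0) := ⟨by simp, by simp, by simp⟩
    have h := H u u' _ _ hu hz (by simp) ((mul_eq_zero.1 h1).resolve_left hkl)
      ((mul_eq_zero.1 h3).resolve_left hl0.ne')
      (by simpa using (mul_eq_zero.1 h4.symm).resolve_left hl0.ne')
    simp only [ne_eq, OfNat.ofNat_ne_zero, not_false_eq_true, zero_pow, mul_zero, add_zero,
      integral_zero] at h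
    rw [LplusPair, hV _ _ fun x => (hpot x).1, hn]
    have h5 : 0 ≤ δ * ∫ y, u' y ^ 2 := mul_nonneg hδ.le (integral_nonneg fun y => sq_nonneg _)
    calc k ^ 2 / 2 * δ * (k⁻¹ * ∫ y, u y ^ 2) = k / 2 * (δ * ∫ y, u y ^ 2) := by
          field_simp
      _ ≤ _ := mul_le_mul_of_nonneg_left (by linarith) (by positivity)
  · obtain ⟨u, u', hu, hpu, hnu, hnu', hVu⟩ := η.re.exists_rescaled hk0
    obtain ⟨v, v', hv, hpv, hnv, hnv', hVv⟩ := η.im.exists_rescaled hk0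
    rw [c1 _ _ hpv] at h1
    rw [c1 _ _ hpu] at h2
    rw [c2 _ _ hpu] at h3
    rw [c3 _ _ hpu, c2 _ _ hpv, ← mul_add] at h4
    have h := H u u' v v' hu hv ((mul_eq_zero.1 h1).resolve_left hkl)
      ((mul_eq_zero.1 h2).resolve_left hkl) ((mul_eq_zero.1 h3).resolve_left hl0.ne')
      ((mul_eq_zero.1 h4).resolve_left hl0.ne')
    have n1 : normSqL2 η.toFun = normSqL2 η.re.toFun + normSqL2 η.im.toFun :=
      normSqL2_complex η.memLp_toFun
    have n2 : normSqL2 η.wderiv = normSqL2 η.re.wderiv + normSqL2 η.im.wderiv :=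
      normSqL2_complex η.memLp_wderiv
    rw [normSqH1, n1, n2, linEnergy, LplusPair, LminusPair, hVu _ _ fun x => (hpot x).1,
      hVv _ _ fun x => (hpot x).2, hnu, hnv, hnu', hnv']
    have p1 : 0 ≤ ∫ y, u y ^ 2 := integral_nonneg fun y => sq_nonneg _
    have p2 : 0 ≤ ∫ y, v y ^ 2 := integral_nonneg fun y => sq_nonneg _
    have p3 : 0 ≤ ∫ y, u' y ^ 2 := integral_nonneg fun y => sq_nonneg _
    have p4 : 0 ≤ ∫ y, v' y ^ 2 := integral_nonneg fun y => sq_nonneg _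
    set U := ∫ y, u y ^ 2
    set V := ∫ y, v y ^ 2
    set U' := ∫ y, u' y ^ 2
    set V' := ∫ y, v' y ^ 2
    have hki : 0 < k⁻¹ := inv_pos.2 hk0
    have b : k⁻¹ * U + k⁻¹ * V + (k * U' + k * V') ≤ (k⁻¹ + k) * ((U + U') + (V + V')) := by
      have b1 : 0 ≤ k * (U + V) := by positivity
      have b2 : 0 ≤ k⁻¹ * (U' + V') := by positivity
      linarith
    calc k / 2 * (δ / (k⁻¹ + k)) * (k⁻¹ * U + k⁻¹ * V + (k * U' + k * V'))
        ≤ k / 2 * (δ / (k⁻¹ + k)) * ((k⁻¹ + k) * ((U + U') + (V + V'))) :=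
          mul_le_mul_of_nonneg_left b (by positivity)
      _ = k / 2 * (δ * ((U + U') + (V + V'))) := by
          have : k⁻¹ + k ≠ 0 := by positivity
          rw [mul_assoc, ← mul_assoc (δ / (k⁻¹ + k)), div_mul_cancel₀ _ this]
      _ ≤ _ := by
          rw [← mul_add]
          exact mul_le_mul_of_nonneg_left h (by positivity)
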